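/- For a discrete group $G$, let $C^*(G)$ be its full (maximal) $C^*$-algebra and $U_G : G \to C^*(G)$ its universal unitary representation. A subset $\Lambda \subset G$ is called completely Sidon if the unitaries $(U_G(t))_{t\in\Lambda}$ span in $C^*(G)$ a copy of $\ell_1(\Lambda)$ equipped with its maximal operator space structure, that is: if there is a constant $C$ such that for every $m \ge 1$ and every finitely supported family $(a_t)_{t\in\Lambda}$ in $M_m(\mathbb C)$, $$\Big\|\sum_{t\in\Lambda} a_t\otimes U_t\Big\|_{M_m(C^*(\mathbb F_\Lambda))} \le C\,\Big\|\sum_{t\in\Lambda} a_t\otimes U_G(t)\Big\|_{M_m(C^*(G))},$$ where $\mathbb F_\Lambda$ is the free group with free generators $(g_t)_{t\in\Lambda}$ and $U_t = U_{\mathbb F_\Lambda}(g_t)$. Let $G$ be any discrete group. If $\Lambda_1,\Lambda_2\subset G$ are completely Sidon, then $\Lambda_1\cup\Lambda_2$ is completely Sidon. -/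

import Mathlib

open scoped ENNReal

universe u

/-- A unitary representation of the (discrete) group `G` on a nonzero complex Hilbert space. -/
structure UnitaryRep (G : Type u) [Group G] : Type (u + 1) where
  /-- The Hilbert space. Every cyclic representation of `G` is unitarily equivalent to one on a
  completion of a quotient of `ℂ[G]`, so spaces in the universe of `G` suffice. -/
  H : Type u
  [normedAddCommGroup : NormedAddCommGroup H]
  [innerProductSpace : InnerProductSpace ℂ H]
  [completeSpace : CompleteSpace H]
  [nontrivial : Nontrivial H]
  /-- The homomorphism into the unitary group of `B(H)`. -/
  hom : G →* unitary (H →L[ℂ] H)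

namespace UnitaryRep

attribute [instance] normedAddCommGroup innerProductSpace completeSpace nontrivial

variable {G : Type u} [Group G]

/-- The `ℓ^∞`-direct sum of the algebras `B(H_π)` over all unitary representations `π` of `G`. -/
abbrev BoundedProduct (G : Type u) [Group G] : Type (u + 1) :=
  lp (fun π : UnitaryRep G => π.H →L[ℂ] π.H) ∞

noncomputable instance : NormedAlgebra ℂ (BoundedProduct G) where
  norm_smul_le := norm_smul_le

noncomputable instance : CStarAlgebra (BoundedProduct G) where

/-- The element `(π(t))_π`, the direct sum of all unitary representations evaluated at `t`. -/
noncomputable def universalElement (t : G) : BoundedProduct G :=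
  ⟨fun π => (π.hom t : π.H →L[ℂ] π.H), memℓp_infty ⟨1, by
    rintro _ ⟨π, rfl⟩
    exact (CStarRing.norm_coe_unitary (π.hom t)).le⟩⟩

end UnitaryRep

/-- The closed unital *-subalgebra generated by the direct sum of all unitary representations
of `G`. -/
noncomputable def groupCStarSubalgebra (G : Type u) [Group G] :
    StarSubalgebra ℂ (UnitaryRep.BoundedProduct G) :=
  (StarAlgebra.adjoin ℂ (Set.range (UnitaryRep.universalElement (G := G)))).topologicalClosure

instance (G : Type u) [Group G] :
    IsClosed (groupCStarSubalgebra G : Set (UnitaryRep.BoundedProduct G)) :=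
  StarSubalgebra.isClosed_topologicalClosure _

/-- The full (maximal) C*-algebra `C*(G)` of the discrete group `G`. -/
def GroupCStar (G : Type u) [Group G] : Type (u + 1) :=
  groupCStarSubalgebra G

namespace GroupCStar

variable {G : Type u} [Group G]

noncomputable instance : CStarAlgebra (GroupCStar G) :=
  inferInstanceAs (CStarAlgebra (groupCStarSubalgebra G))

/-- The usual order of the C*-algebra `C*(G)`. -/
noncomputable instance : PartialOrder (GroupCStar G) :=
  CStarAlgebra.spectralOrder (GroupCStar G)

instance : StarOrderedRing (GroupCStar G) :=
  CStarAlgebra.spectralOrderedRing (GroupCStar G)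

/-- The element `U_G(t)` of `C*(G)`. -/
noncomputable def universalUnitary (t : G) : GroupCStar G :=
  (⟨UnitaryRep.universalElement t, StarSubalgebra.le_topologicalClosure _
    (StarAlgebra.subset_adjoin ℂ _ (Set.mem_range_self t))⟩ : groupCStarSubalgebra G)

theorem universalUnitary_mem (t : G) : universalUnitary t ∈ unitary (GroupCStar G) := by
  rw [Unitary.mem_iff]
  constructor <;> apply Subtype.ext <;> apply lp.ext <;> funext π
  · exact Unitary.coe_star_mul_self (π.hom t)
  · exact Unitary.coe_mul_star_self (π.hom t)

/-- The universal unitary representation `U_G` of `G` in `C*(G)`. -/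
noncomputable def universalRep : G →* unitary (GroupCStar G) where
  toFun t := ⟨universalUnitary t, universalUnitary_mem t⟩
  map_one' := by
    apply Subtype.ext; apply Subtype.ext; apply lp.ext; funext π
    exact congrArg Subtype.val (map_one π.hom)
  map_mul' s t := by
    apply Subtype.ext; apply Subtype.ext; apply lp.ext; funext π
    exact congrArg Subtype.val (map_mul π.hom s t)

end GroupCStar

/-- The element `∑_{i ∈ s} a_i ⊗ x_i` of `M_m ⊗ A = M_m(A)`. The norm of `CStarMatrix` is the
C*-norm of `M_m(A)`, that is, the minimal tensor norm. -/
def matrixCoeffSum {ι A : Type*} [AddCommMonoid A] [SMul ℂ A] {m : ℕ}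
    (s : Finset ι) (a : ι → Matrix (Fin m) (Fin m) ℂ) (x : ι → A) :
    CStarMatrix (Fin m) (Fin m) A :=
  CStarMatrix.ofMatrix (Matrix.of fun p q => ∑ i ∈ s, a i p q • x i)

/-- A bounded family `(ψ_i)` in a C*-algebra `A` is completely Sidon if, for some constant `C`,
`‖∑ a_i ⊗ U_i‖ ≤ C ‖∑ a_i ⊗ ψ_i‖` for all finite sums with matrix coefficients `a_i` of any size,
where the `U_i` are the canonical unitary generators of the full C*-algebra of the free group on
the index set. The span of the `U_i` is `ℓ₁` with its maximal operator space structure. -/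
def IsCompletelySidon {ι : Type u} {A : Type*} [NonUnitalCStarAlgebra A] [PartialOrder A]
    [StarOrderedRing A] (ψ : ι → A) : Prop :=
  (∃ R : ℝ, ∀ i, ‖ψ i‖ ≤ R) ∧
  ∃ C : ℝ, ∀ (m : ℕ) (s : Finset ι) (a : ι → Matrix (Fin m) (Fin m) ℂ),
    ‖matrixCoeffSum s a
        (fun i => (GroupCStar.universalRep (FreeGroup.of i) : GroupCStar (FreeGroup ι)))‖ ≤
      C * ‖matrixCoeffSum s a ψ‖

/-- A subset `Λ` of a discrete group `G` is completely Sidon if the family `(U_G(t))_{t ∈ Λ}` is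
completely Sidon in `C*(G)`. -/
def IsCompletelySidonSet {G : Type u} [Group G] (Λ : Set G) : Prop :=
  IsCompletelySidon (fun t : Λ => (GroupCStar.universalRep (t : G) : GroupCStar G))

/-! The theorem follows once the indicator function of a completely Sidon set is approximated
uniformly by completely bounded multipliers of `C*(G)` (`exists_multiplier_of_sidon`). Such a
multiplier `f` for `Λ₁` nearly cuts a sum over `Λ₁ ∪ Λ₂` down to `Λ₁`. The error has coefficients of
size at most `ε`, so its norm is at most `ε` times the norm of the free sum. Applying the Sidon
inequalities to the parts over `Λ₁` and `Λ₂ \ Λ₁` bounds the free norm by a multiple of the norm in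
`C*(G)` plus half of itself, which is absorbed.

To build `f`, let `F` be the free group on `Λ`. The Sidon inequality yields a `2 × 2` matrix-valued
positive definite function `s` on `G × F` whose diagonal entries at `(1, w)` are `C` for `w = 1` and
`0` otherwise, and whose corner at `(t, w)`, `t ∈ Λ`, is `1` for `w = g_t` and `0` otherwise
(`exists_isPosDefFun_of_sidon`). This is a Hahn–Banach extension; its positivity is checked in
finite quotients of `F`, where elements of the group algebra become matrix coefficients.

On `F`, Haagerup's function `r ^ |w|`, cut down by degree modulo `3`, is `r` at generators and at
most `r ^ 2` at other words. It is carried to `G` by summing its product with `s`, `star s` and the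
indicator of the graph of `F → G` over `F`. Traciality on `F` keeps the sum positive definite
(`IsPosDefFun.tsum_mul_star`), and Bessel's inequality bounds it off `Λ` by `r ^ 2 * C ^ 2`.
Division by `r` gives `f`, with error at most `r * C ^ 2`. -/

open scoped ComplexOrder Matrix

/-! ### Norms in `M_m(C*(G))` through sesquilinear forms in representations. -/

section OperatorMatrix

variable {n H : Type*} [Fintype n] [NormedAddCommGroup H] [InnerProductSpace ℂ H]

/-- The operator on `H^n` with the given matrix of operators on `H`. -/
noncomputable def opOfMatrix (M : n → n → H →L[ℂ] H) :
    PiLp 2 (fun _ : n => H) →L[ℂ] PiLp 2 (fun _ : n => H) :=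
  (PiLp.continuousLinearEquiv 2 ℂ (fun _ : n => H)).symm.toContinuousLinearMap ∘L
    ContinuousLinearMap.pi fun p => ∑ q, M p q ∘L PiLp.proj 2 (fun _ : n => H) q

theorem opOfMatrix_apply (M : n → n → H →L[ℂ] H) (ξ : PiLp 2 (fun _ : n => H)) (p : n) :
    opOfMatrix M ξ p = ∑ q, M p q (ξ q) := by
  simp [opOfMatrix]

theorem inner_opOfMatrix (M : n → n → H →L[ℂ] H) (ξ η : PiLp 2 (fun _ : n => H)) :
    inner ℂ ξ (opOfMatrix M η) = ∑ p, ∑ q, inner ℂ (ξ p) (M p q (η q)) := by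
  simp [PiLp.inner_apply, opOfMatrix_apply, inner_sum]

/-- For unit vectors the arithmetic mean of squares equals the product of norms. The mean is
preferred because it is additive over coordinates and turns norm bounds into positivity statements.
-/
theorem norm_opOfMatrix_le_iff (M : n → n → H →L[ℂ] H) {R : ℝ} (hR : 0 ≤ R) :
    ‖opOfMatrix M‖ ≤ R ↔ ∀ ξ η : n → H,
      ‖∑ p, ∑ q, inner ℂ (ξ p) (M p q (η q))‖ ≤
        R * (((∑ p, ‖ξ p‖ ^ 2) + ∑ q, ‖η q‖ ^ 2) / 2) := by
  constructor
  · intro h ξ η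
    have h1 := inner_opOfMatrix M (WithLp.toLp 2 ξ) (WithLp.toLp 2 η)
    rw [← h1]
    have h2 : ∀ ζ : n → H, ∑ p, ‖ζ p‖ ^ 2 = ‖(WithLp.toLp 2 ζ : PiLp 2 (fun _ : n => H))‖ ^ 2 :=
      fun ζ => by rw [PiLp.norm_sq_eq_of_L2]
    rw [h2, h2]
    calc _ ≤ ‖WithLp.toLp 2 ξ‖ * ‖opOfMatrix M (WithLp.toLp 2 η)‖ := norm_inner_le_norm _ _
      _ ≤ ‖WithLp.toLp 2 ξ‖ * (R * ‖WithLp.toLp 2 η‖) := by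
        gcongr; exact (opOfMatrix M).le_of_opNorm_le h _
      _ = R * (‖WithLp.toLp 2 ξ‖ * ‖WithLp.toLp 2 η‖) := by ring
      _ ≤ _ := by
        gcongr
        nlinarith [sq_nonneg (‖WithLp.toLp 2 ξ‖ - ‖WithLp.toLp 2 η‖)]
  · intro h
    refine ContinuousLinearMap.opNorm_le_of_re_inner_le hR fun η ξ hη hξ => ?_
    have h2 : ∀ ζ : PiLp 2 (fun _ : n => H), ‖ζ‖ = 1 → ∑ p, ‖ζ p‖ ^ 2 = 1 :=
      fun ζ hζ => by rw [← PiLp.norm_sq_eq_of_L2, hζ, one_pow]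
    have h1 := h ξ η
    rw [h2 _ hη, h2 _ hξ, ← inner_opOfMatrix] at h1
    refine (RCLike.re_le_norm _).trans ?_
    rw [norm_inner_symm]
    linarith

theorem opOfMatrix_injective (M : n → n → H →L[ℂ] H) (h : opOfMatrix M = 0) (p q : n) :
    M p q = 0 := by
  classical
  ext x
  have := congrArg (fun T => T (PiLp.single 2 q x) p) h
  simpa [opOfMatrix_apply, Pi.single_apply, apply_ite] using this

variable [CompleteSpace H]

/-- `opOfMatrix` as a star homomorphism. -/
noncomputable def opOfMatrixHom :
    CStarMatrix n n (H →L[ℂ] H) →⋆ₙₐ[ℂ]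
      (PiLp 2 (fun _ : n => H) →L[ℂ] PiLp 2 (fun _ : n => H)) where
  toFun M := opOfMatrix fun p q => M p q
  map_smul' c M := by
    ext ξ p
    simp [opOfMatrix_apply, Finset.smul_sum]
  map_zero' := by
    ext ξ p
    simp [opOfMatrix_apply]
  map_add' M N := by
    ext ξ p
    simp [opOfMatrix_apply, Finset.sum_add_distrib]
  map_mul' M N := by
    ext ξ p
    rw [mul_apply_eq_comp]
    simp only [opOfMatrix_apply, CStarMatrix.mul_apply, sum_apply, map_sum,
      mul_apply_eq_comp]
    rw [Finset.sum_comm]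
  map_star' M := by
    rw [ContinuousLinearMap.star_eq_adjoint, ContinuousLinearMap.eq_adjoint_iff]
    intro ξ η
    rw [inner_opOfMatrix, ← inner_conj_symm, inner_opOfMatrix, map_sum, Finset.sum_comm]
    refine Finset.sum_congr rfl fun p _ => ?_
    rw [map_sum]
    refine Finset.sum_congr rfl fun q _ => ?_
    rw [inner_conj_symm, CStarMatrix.star_apply, ContinuousLinearMap.star_eq_adjoint,
      ContinuousLinearMap.adjoint_inner_left]

end OperatorMatrix

/-- A family of star homomorphisms that is jointly injective is jointly isometric. -/
theorem norm_le_iff_of_jointly_injective {κ A : Type*} {B : κ → Type*}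
    [NonUnitalCStarAlgebra A] [∀ i, NonUnitalCStarAlgebra (B i)] (φ : ∀ i, A →⋆ₙₐ[ℂ] B i)
    (hφ : ∀ a, (∀ i, φ i a = 0) → a = 0) (a : A) {R : ℝ} (hR : 0 ≤ R) :
    ‖a‖ ≤ R ↔ ∀ i, ‖φ i a‖ ≤ R := by
  refine ⟨fun h i => (NonUnitalStarAlgHom.norm_apply_le (φ i) a).trans h, fun h => ?_⟩
  let Φ : A →⋆ₙₐ[ℂ] lp B ∞ :=
    { toFun := fun a => ⟨fun i => φ i a, memℓp_infty ⟨‖a‖, by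
        rintro _ ⟨i, rfl⟩
        exact NonUnitalStarAlgHom.norm_apply_le (φ i) a⟩⟩
      map_smul' := fun c x => by ext1; funext i; exact map_smul (φ i) c x
      map_zero' := by ext1; funext i; exact map_zero (φ i)
      map_add' := fun x y => by ext1; funext i; exact map_add (φ i) x y
      map_mul' := fun x y => by ext1; funext i; exact map_mul (φ i) x y
      map_star' := fun x => by ext1; funext i; exact map_star (φ i) x }
  have hΦ : Function.Injective Φ := by
    rw [injective_iff_map_eq_zero]
    exact fun x hx => hφ x fun i => congrArg (fun f : lp B ∞ => f i) hx
  rw [← NonUnitalStarAlgHom.norm_map Φ hΦ a]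
  exact lp.norm_le_of_forall_le hR h

namespace GroupCStar

variable {G : Type u} [Group G]

/-- The star homomorphism `C*(G) → B(H_π)` induced by a unitary representation. -/
noncomputable def evalRep (π : UnitaryRep G) : GroupCStar G →⋆ₙₐ[ℂ] (π.H →L[ℂ] π.H) where
  toFun x := (Subtype.val (p := fun y => y ∈ groupCStarSubalgebra G) x) π
  map_smul' _ _ := rfl
  map_zero' := rfl
  map_add' _ _ := rfl
  map_mul' _ _ := rfl
  map_star' _ := rfl

theorem evalRep_universalRep (π : UnitaryRep G) (t : G) :
    evalRep π (universalRep t : GroupCStar G) = π.hom t := rfl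

theorem eq_zero_of_evalRep {x : GroupCStar G} (h : ∀ π, evalRep π x = 0) : x = 0 := by
  apply Subtype.ext; apply lp.ext; funext π
  exact h π

variable {m : ℕ}

/-- The star homomorphism `M_m(C*(G)) → B(H_π^m)` induced by a unitary representation. -/
noncomputable def evalMatrix (m : ℕ) (π : UnitaryRep G) :
    CStarMatrix (Fin m) (Fin m) (GroupCStar G) →⋆ₙₐ[ℂ]
      (PiLp 2 (fun _ : Fin m => π.H) →L[ℂ] PiLp 2 (fun _ : Fin m => π.H)) :=
  opOfMatrixHom.comp (CStarMatrix.mapₙₐ (evalRep π))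

theorem evalMatrix_apply (π : UnitaryRep G) (M : CStarMatrix (Fin m) (Fin m) (GroupCStar G)) :
    evalMatrix m π M = opOfMatrix fun p q => evalRep π (M p q) := rfl

theorem norm_le_iff_forall_evalMatrix (M : CStarMatrix (Fin m) (Fin m) (GroupCStar G))
    {R : ℝ} (hR : 0 ≤ R) : ‖M‖ ≤ R ↔ ∀ π : UnitaryRep G, ‖evalMatrix m π M‖ ≤ R := by
  refine norm_le_iff_of_jointly_injective (fun π => evalMatrix m π) (fun M hM => ?_) M hR
  ext p q
  refine eq_zero_of_evalRep fun π => ?_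
  have h := hM π
  rw [evalMatrix_apply] at h
  exact opOfMatrix_injective _ h p q

end GroupCStar

/-- The sesquilinear form of `∑_{i ∈ s} a_i ⊗ π(g_i)` at the pair of vectors `ξ, η` of `H_π^n`. -/
noncomputable def UnitaryRep.coeffForm {G : Type u} [Group G] {ι n : Type*} [Fintype n]
    (π : UnitaryRep G) (s : Finset ι) (a : ι → Matrix n n ℂ) (g : ι → G) (ξ η : n → π.H) : ℂ :=
  ∑ p, ∑ q, ∑ i ∈ s, a i p q * inner ℂ (ξ p) ((π.hom (g i) : π.H →L[ℂ] π.H) (η q))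

/-- The norm of a matrix sum of universal unitaries is the best constant in the inequalities for
the associated sesquilinear forms in all representations. -/
theorem norm_matrixCoeffSum_le_iff {G : Type u} [Group G] {ι : Type*} {m : ℕ} (s : Finset ι)
    (a : ι → Matrix (Fin m) (Fin m) ℂ) (g : ι → G) {R : ℝ} (hR : 0 ≤ R) :
    ‖matrixCoeffSum s a (fun i => (GroupCStar.universalRep (g i) : GroupCStar G))‖ ≤ R ↔
      ∀ (π : UnitaryRep G) (ξ η : Fin m → π.H),
        ‖π.coeffForm s a g ξ η‖ ≤ R * (((∑ p, ‖ξ p‖ ^ 2) + ∑ q, ‖η q‖ ^ 2) / 2) := by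
  rw [GroupCStar.norm_le_iff_forall_evalMatrix _ hR]
  refine forall_congr' fun π => ?_
  rw [GroupCStar.evalMatrix_apply, norm_opOfMatrix_le_iff _ hR]
  have : ∀ ξ η : Fin m → π.H, π.coeffForm s a g ξ η = ∑ p, ∑ q, inner ℂ (ξ p)
      (GroupCStar.evalRep π (matrixCoeffSum s a
        (fun i => (GroupCStar.universalRep (g i) : GroupCStar G)) p q) (η q)) := by
    intro ξ η
    unfold UnitaryRep.coeffForm matrixCoeffSum
    refine Finset.sum_congr rfl fun p _ => Finset.sum_congr rfl fun q _ => ?_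
    simp only [CStarMatrix.ofMatrix_apply, Matrix.of_apply, map_sum, map_smul,
      GroupCStar.evalRep_universalRep, sum_apply, inner_sum,
      smul_apply, inner_smul_right]
  simp only [this]

/-! ### Gram vectors and the GNS construction for positive semidefinite kernels. -/

section Gram

variable {X H : Type*} [NormedAddCommGroup H] [InnerProductSpace ℂ H]

theorem finsupp_sum_gram (v : X → H) (c d : X →₀ ℂ) :
    (c.sum fun x cx => d.sum fun y dy => star cx * inner ℂ (v x) (v y) * dy) =
      inner ℂ (Finsupp.linearCombination ℂ v c) (Finsupp.linearCombination ℂ v d) := by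
  simp only [Finsupp.linearCombination_apply, Finsupp.sum, sum_inner, inner_sum,
    inner_smul_left, inner_smul_right]
  rw [Finset.sum_comm]
  refine Finset.sum_congr rfl fun x _ => ?_
  rw [Finset.mul_sum]
  refine Finset.sum_congr rfl fun y _ => ?_
  rw [starRingEnd_apply]; ring

theorem posSemidef_of_inner_eq {M : Matrix X X ℂ} (v : X → H)
    (h : ∀ x y, M x y = inner ℂ (v x) (v y)) : M.PosSemidef := by
  refine ⟨?_, fun c => ?_⟩
  · ext x y
    rw [Matrix.conjTranspose_apply, h, h, RCLike.star_def, inner_conj_symm]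
  · simp only [h]
    rw [finsupp_sum_gram, inner_self_eq_norm_sq_to_K]
    simp

end Gram

/-- Null vectors need no explicit quotient: the completion of a seminormed space is already
Hausdorff. -/
theorem Matrix.PosSemidef.exists_vectors {X : Type u} {M : Matrix X X ℂ} (hM : M.PosSemidef) :
    ∃ (H : Type u) (_ : NormedAddCommGroup H) (_ : InnerProductSpace ℂ H) (_ : CompleteSpace H)
      (v : X → H), (∀ x y, inner ℂ (v x) (v y) = M x y) ∧
        DenseRange (Finsupp.linearCombination ℂ v) := by
  let core : PreInnerProductSpace.Core ℂ (X →₀ ℂ) :=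
    { inner := fun c d => c.sum fun x cx => d.sum fun y dy => star cx * M x y * dy
      conj_inner_symm := fun c d => by
        rw [Finsupp.sum_comm]
        simp only [Finsupp.sum, map_sum, map_mul]
        refine Finset.sum_congr rfl fun x _ => Finset.sum_congr rfl fun y _ => ?_
        rw [← hM.isHermitian.apply y x]
        simp only [RCLike.star_def, Complex.conj_conj]
        ring
      re_inner_nonneg := fun c => (RCLike.nonneg_iff.mp (hM.2 c)).1
      add_left := fun c d e => by
        rw [Finsupp.sum_add_index'] <;> intros <;> simp [add_mul, Finsupp.sum_add]
      smul_left := fun c d r => by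
        rw [Finsupp.sum_smul_index']
        · simp only [Finsupp.mul_sum, smul_eq_mul, star_mul', RCLike.star_def, mul_assoc]
        · simp }
  let _ : SeminormedAddCommGroup (X →₀ ℂ) :=
    @InnerProductSpace.Core.toSeminormedAddCommGroup ℂ (X →₀ ℂ) _ _ _ core
  let _ : InnerProductSpace ℂ (X →₀ ℂ) := InnerProductSpace.ofCore core
  let v : X → UniformSpace.Completion (X →₀ ℂ) := fun x => ((Finsupp.single x (1 : ℂ) : X →₀ ℂ) :)
  refine ⟨UniformSpace.Completion (X →₀ ℂ), inferInstance, inferInstance, inferInstance,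
    v, fun x y => ?_, ?_⟩
  · rw [UniformSpace.Completion.inner_coe]
    change Finsupp.sum _ _ = _
    simp
  · have : ⇑(Finsupp.linearCombination ℂ v) =
        ((↑) : (X →₀ ℂ) → UniformSpace.Completion (X →₀ ℂ)) := by
      have h2 : Finsupp.linearCombination ℂ v =
          (UniformSpace.Completion.toComplL (𝕜 := ℂ) (E := X →₀ ℂ)).toLinearMap := by
        ext x
        simp [v]
      funext c
      rw [h2]; rfl
    rw [this]
    exact UniformSpace.Completion.denseRange_coe

section DenseVectors

variable {X H H' : Type*} [NormedAddCommGroup H] [InnerProductSpace ℂ H]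
  [NormedAddCommGroup H'] [InnerProductSpace ℂ H']

theorem norm_linearCombination_eq_of_inner_eq {v : X → H} {v' : X → H'}
    (h : ∀ x y, inner ℂ (v' x) (v' y) = inner ℂ (v x) (v y)) (c : X →₀ ℂ) :
    ‖Finsupp.linearCombination ℂ v' c‖ = ‖Finsupp.linearCombination ℂ v c‖ := by
  have := finsupp_sum_gram v' c c
  simp only [h] at this
  rw [finsupp_sum_gram v c c] at this
  rw [@norm_eq_sqrt_re_inner ℂ, @norm_eq_sqrt_re_inner ℂ, this]

theorem exists_clm_of_inner_eq [CompleteSpace H'] {v : X → H} {v' : X → H'}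
    (hv : DenseRange (Finsupp.linearCombination ℂ v))
    (h : ∀ x y, inner ℂ (v' x) (v' y) = inner ℂ (v x) (v y)) :
    ∃ T : H →L[ℂ] H', ∀ x, T (v x) = v' x := by
  refine ⟨(Finsupp.linearCombination ℂ v').extendOfNorm (Finsupp.linearCombination ℂ v),
    fun x => ?_⟩
  have := LinearMap.extendOfNorm_eq (f := Finsupp.linearCombination ℂ v') hv
    ⟨1, fun c => by rw [one_mul, norm_linearCombination_eq_of_inner_eq h]⟩ (Finsupp.single x 1)
  simpa using this

theorem clm_ext_of_dense {v : X → H} (hv : DenseRange (Finsupp.linearCombination ℂ v))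
    {S T : H →L[ℂ] H'} (h : ∀ x, S (v x) = T (v x)) : S = T := by
  refine ContinuousLinearMap.coeFn_injective
    (hv.equalizer S.continuous T.continuous (funext fun c => ?_))
  simp only [Function.comp_apply, Finsupp.linearCombination_apply, Finsupp.sum, map_sum, map_smul,
    h]

end DenseVectors

/-- A positive semidefinite kernel that is invariant under a group action comes from a unitary
representation. -/
theorem Matrix.PosSemidef.exists_unitary {Γ X : Type u} [Group Γ] [MulAction Γ X]
    {M : Matrix X X ℂ} (hM : M.PosSemidef) (hinv : ∀ (g : Γ) x y, M (g • x) (g • y) = M x y) :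
    ∃ (H : Type u) (_ : NormedAddCommGroup H) (_ : InnerProductSpace ℂ H) (_ : CompleteSpace H)
      (v : X → H) (ρ : Γ →* unitary (H →L[ℂ] H)), (∀ x y, inner ℂ (v x) (v y) = M x y) ∧
        DenseRange (Finsupp.linearCombination ℂ v) ∧
        ∀ g x, (ρ g : H →L[ℂ] H) (v x) = v (g • x) := by
  obtain ⟨H, _, _, _, v, hv, hd⟩ := hM.exists_vectors
  have : ∀ g : Γ, ∃ T : H →L[ℂ] H, ∀ x, T (v x) = v (g • x) := fun g =>
    exists_clm_of_inner_eq hd fun x y => by rw [hv, hv, hinv]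
  choose T hT using this
  have hT1 : T 1 = 1 := clm_ext_of_dense hd fun x => by simp [hT]
  have hTm : ∀ g h, T (g * h) = T g * T h := fun g h => clm_ext_of_dense hd fun x => by
    simp [hT, mul_smul]
  have hstar : ∀ g, star (T g) = T g⁻¹ := fun g => by
    rw [ContinuousLinearMap.star_eq_adjoint]
    refine clm_ext_of_dense hd fun x => ?_
    -- Vectors are compared through the functionals they define, so that density of the span can be
    -- used in the second variable too.
    have h2 : innerSL ℂ (ContinuousLinearMap.adjoint (T g) (v x)) = innerSL ℂ (T g⁻¹ (v x)) := by
      refine clm_ext_of_dense hd fun y => ?_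
      rw [innerSL_apply_apply, innerSL_apply_apply, ContinuousLinearMap.adjoint_inner_left, hT, hT,
        hv, hv, ← hinv g⁻¹, inv_smul_smul]
    refine ext_inner_right ℂ fun z => ?_
    simpa using congrArg (fun f => f z) h2
  have hu : ∀ g, T g ∈ unitary (H →L[ℂ] H) := fun g => by
    rw [Unitary.mem_iff, hstar, ← hTm, ← hTm, inv_mul_cancel, mul_inv_cancel, hT1]
    exact ⟨rfl, rfl⟩
  exact ⟨H, inferInstance, inferInstance, inferInstance, v,
    { toFun := fun g => ⟨T g, hu g⟩
      map_one' := Subtype.ext hT1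
      map_mul' := fun g h => Subtype.ext (hTm g h) }, hv, hd, hT⟩

/-! ### Matrix-valued positive definite functions and the multipliers they define. -/

/-- A matrix-valued function on a group is positive definite if the corresponding translation
invariant kernel is positive semidefinite. -/
def IsPosDefFun {Γ J : Type*} [Group Γ] (κ : J → J → Γ → ℂ) : Prop :=
  (Matrix.of fun x y : Γ × J => κ x.2 y.2 (x.1⁻¹ * y.1)).PosSemidef

namespace IsPosDefFun

variable {Γ J H : Type*} [Group Γ]

theorem mul {κ κ' : J → J → Γ → ℂ} (h : IsPosDefFun κ) (h' : IsPosDefFun κ') :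
    IsPosDefFun fun i j g => κ i j g * κ' i j g :=
  h.hadamard h'

theorem of_inner [NormedAddCommGroup H] [InnerProductSpace ℂ H] {κ : J → J → Γ → ℂ}
    (v : Γ → J → H) (h : ∀ i j x y, κ i j (x⁻¹ * y) = inner ℂ (v x i) (v y j)) :
    IsPosDefFun κ :=
  posSemidef_of_inner_eq (fun x : Γ × J => v x.1 x.2) fun _ _ => h _ _ _ _

theorem star_apply {κ : J → J → Γ → ℂ} (h : IsPosDefFun κ) (i j : J) (γ : Γ) :
    star (κ i j γ) = κ j i γ⁻¹ := by
  have := Matrix.IsHermitian.apply (Matrix.PosSemidef.isHermitian h) (γ, j) (1, i)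
  simpa using this

theorem comp_hom {Δ : Type*} [Group Δ] {κ : J → J → Γ → ℂ} (h : IsPosDefFun κ) (φ : Δ →* Γ) :
    IsPosDefFun fun i j g => κ i j (φ g) := by
  have h2 := Matrix.PosSemidef.submatrix h (fun x : Δ × J => (φ x.1, x.2))
  unfold IsPosDefFun
  convert h2 using 1
  ext x y
  simp

end IsPosDefFun

theorem UnitaryRep.inner_hom_hom {G : Type u} [Group G] (π : UnitaryRep G) (x y : G)
    (ξ η : π.H) : inner ℂ ((π.hom x : π.H →L[ℂ] π.H) ξ) ((π.hom y : π.H →L[ℂ] π.H) η) =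
      inner ℂ ξ ((π.hom (x⁻¹ * y) : π.H →L[ℂ] π.H) η) := by
  rw [← ContinuousLinearMap.adjoint_inner_right, ← ContinuousLinearMap.star_eq_adjoint,
    ← Unitary.coe_star, Unitary.star_eq_inv, ← map_inv, map_mul]
  rfl

namespace IsPosDefFun

theorem comp_index {Γ J J' : Type*} [Group Γ] {κ : J → J → Γ → ℂ} (h : IsPosDefFun κ)
    (f : J' → J) : IsPosDefFun fun i j g => κ (f i) (f j) g :=
  Matrix.PosSemidef.submatrix h (fun x : Γ × J' => (x.1, f x.2))

theorem of_rep {G : Type u} [Group G] {J : Type*} (π : UnitaryRep G) (ζ : J → π.H) :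
    IsPosDefFun fun i j g => inner ℂ (ζ i) ((π.hom g : π.H →L[ℂ] π.H) (ζ j)) := by
  exact of_inner (fun x i => (π.hom x : π.H →L[ℂ] π.H) (ζ i)) fun i j x y =>
    (π.inner_hom_hom _ _ _ _).symm

/-- `J : Type` keeps `Γ × J`, hence the Hilbert space, in the universe that `UnitaryRep` demands. -/
theorem exists_rep {Γ : Type u} {J : Type} [Group Γ] {κ : J → J → Γ → ℂ} (h : IsPosDefFun κ) :
    ∃ (H : Type u) (_ : NormedAddCommGroup H) (_ : InnerProductSpace ℂ H) (_ : CompleteSpace H)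
      (v : J → H) (ρ : Γ →* unitary (H →L[ℂ] H)),
        ∀ i j g, inner ℂ (v i) ((ρ g : H →L[ℂ] H) (v j)) = κ i j g := by
  let _ : MulAction Γ (Γ × J) :=
    { smul := fun g x => (g * x.1, x.2)
      one_smul := fun x => Prod.ext (one_mul _) rfl
      mul_smul := fun g h x => Prod.ext (mul_assoc _ _ _) rfl }
  have hs : ∀ (g : Γ) (x : Γ × J), g • x = (g * x.1, x.2) := fun _ _ => rfl
  obtain ⟨H, i1, i2, i3, v, ρ, hv, -, hρ⟩ := Matrix.PosSemidef.exists_unitary (Γ := Γ) h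
    fun g x y => by simp [hs, mul_assoc]
  refine ⟨H, i1, i2, i3, fun j => v (1, j), ρ, fun i j g => ?_⟩
  rw [hρ, hs, hv]
  simp

end IsPosDefFun

/-- Multiplication by a corner of a positive definite function is a completely bounded map of
`C*(G)`. -/
theorem norm_matrixCoeffSum_mul_le {G : Type u} [Group G] {h : Fin 2 → Fin 2 → G → ℂ}
    (hh : IsPosDefFun h) {D : ℝ} (h0 : h 0 0 1 ≤ D) (h1 : h 1 1 1 ≤ D)
    {ι : Type*} {m : ℕ} (s : Finset ι) (a : ι → Matrix (Fin m) (Fin m) ℂ) (g : ι → G) :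
    ‖matrixCoeffSum s (fun i => h 0 1 (g i) • a i)
        (fun i => (GroupCStar.universalRep (g i) : GroupCStar G))‖ ≤
      D * ‖matrixCoeffSum s a (fun i => (GroupCStar.universalRep (g i) : GroupCStar G))‖ := by
  have hpos : ∀ i, 0 ≤ h i i 1 := fun i => by
    simpa using Matrix.PosSemidef.diag_nonneg hh (i := (1, i))
  have hle : ∀ i, h i i 1 ≤ D := fun i => by fin_cases i <;> assumption
  have hD : 0 ≤ D := by exact_mod_cast (hpos 0).trans (hle 0)
  rw [norm_matrixCoeffSum_le_iff _ _ _ (by positivity)]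
  intro π ξ η
  -- With `ξ` and `η` in one family, the Schur product of its matrix coefficients with `h` has GNS
  -- vectors whose `(0, 1)` corner carries the factor `h 0 1`, while squared norms grow by a factor
  -- of at most `D`.
  let ζ : Fin 2 × Fin m → π.H := fun x => if x.1 = 0 then ξ x.2 else η x.2
  have hκ := (IsPosDefFun.of_rep π ζ).mul (hh.comp_index (Prod.fst : Fin 2 × Fin m → Fin 2))
  obtain ⟨H, i1, i2, i3, v, ρ, hv⟩ := hκ.exists_rep
  have hnorm : ∀ x, ‖v x‖ ^ 2 ≤ D * ‖ζ x‖ ^ 2 := fun x => by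
    have this : (‖v x‖ : ℂ) ^ 2 = (‖ζ x‖ : ℂ) ^ 2 * h x.1 x.1 1 := by
      have := hv x x 1
      simp only [map_one, OneMemClass.coe_one, one_apply_eq_self,
        inner_self_eq_norm_sq_to_K] at this
      exact this
    have h2 := mul_le_mul_of_nonneg_left (hle x.1)
      (show (0 : ℂ) ≤ (‖ζ x‖ : ℂ) ^ 2 by simp)
    rw [← this] at h2
    rw [mul_comm]
    exact_mod_cast h2
  have hform : π.coeffForm s (fun i => h 0 1 (g i) • a i) g ξ η =
      ∑ p, ∑ q, ∑ i ∈ s, a i p q * inner ℂ (v (0, p)) ((ρ (g i) : H →L[ℂ] H) (v (1, q))) := by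
    unfold UnitaryRep.coeffForm
    simp only [hv, ζ]
    refine Finset.sum_congr rfl fun p _ => Finset.sum_congr rfl fun q _ =>
      Finset.sum_congr rfl fun i _ => ?_
    simp
    ring
  rw [hform]
  -- A `UnitaryRep` must be nonzero, so the zero space is treated apart.
  rcases subsingleton_or_nontrivial H with hH | hH
  · simp only [Subsingleton.elim (v _) 0, inner_zero_left, mul_zero, Finset.sum_const_zero,
      norm_zero]
    positivity
  · have key := (norm_matrixCoeffSum_le_iff s a g (norm_nonneg _)).mp le_rfl
      (UnitaryRep.mk H ρ) (fun p => v (0, p)) (fun q => v (1, q))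
    refine key.trans ?_
    rw [mul_comm D, mul_assoc]
    gcongr
    rw [← mul_div_assoc, mul_add, Finset.mul_sum, Finset.mul_sum]
    gcongr with p _ q _
    · simpa [ζ] using hnorm (0, p)
    · simpa [ζ] using hnorm (1, q)

/-! ### Comparison with the free unitaries, and residual finiteness of free groups. -/

section FreeGroup

variable {G ι : Type u} [Group G] {m : ℕ}

/-- By freeness, the unitaries `z i • π (g i)` extend to a representation of the free group. -/
theorem norm_matrixCoeffSum_unimodular_le (s : Finset ι) (a : ι → Matrix (Fin m) (Fin m) ℂ)
    (g : ι → G) {z : ι → ℂ} (hz : ∀ i, ‖z i‖ = 1) :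
    ‖matrixCoeffSum s (fun i => z i • a i)
        (fun i => (GroupCStar.universalRep (g i) : GroupCStar G))‖ ≤
      ‖matrixCoeffSum s a
        (fun i => (GroupCStar.universalRep (FreeGroup.of i) : GroupCStar (FreeGroup ι)))‖ := by
  rw [norm_matrixCoeffSum_le_iff _ _ _ (norm_nonneg _)]
  intro π ξ η
  have hu : ∀ i, z i • (π.hom (g i) : π.H →L[ℂ] π.H) ∈ unitary (π.H →L[ℂ] π.H) := fun i => by
    have hz' : star (z i) * z i = 1 := by
      rw [RCLike.star_def, ← Complex.normSq_eq_conj_mul_self, Complex.normSq_eq_norm_sq, hz]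
      simp
    rw [Unitary.mem_iff, star_smul, smul_mul_smul_comm, smul_mul_smul_comm, hz',
      mul_comm (z i), hz']
    simp
  let σ : UnitaryRep (FreeGroup ι) := UnitaryRep.mk π.H (FreeGroup.lift fun i => ⟨_, hu i⟩)
  have hform : π.coeffForm s (fun i => z i • a i) g ξ η =
      σ.coeffForm s a FreeGroup.of ξ η := by
    unfold UnitaryRep.coeffForm
    refine Finset.sum_congr rfl fun p _ => Finset.sum_congr rfl fun q _ =>
      Finset.sum_congr rfl fun i _ => ?_
    simp only [σ, FreeGroup.lift_apply_of, smul_apply, inner_smul_right,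
      Matrix.smul_apply, smul_eq_mul]
    ring
  rw [hform]
  exact (norm_matrixCoeffSum_le_iff s a _ (norm_nonneg _)).mp le_rfl σ ξ η

theorem matrixCoeffSum_smul {A : Type*} [AddCommGroup A] [Module ℂ A] {ι : Type*} (s : Finset ι)
    (a : ι → Matrix (Fin m) (Fin m) ℂ) (x : ι → A) (c : ℂ) :
    matrixCoeffSum s (fun i => c • a i) x = c • matrixCoeffSum s a x := by
  ext p q
  simp [matrixCoeffSum, Finset.smul_sum, mul_smul]

theorem matrixCoeffSum_add {A : Type*} [AddCommGroup A] [Module ℂ A] {ι : Type*} (s : Finset ι)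
    (a b : ι → Matrix (Fin m) (Fin m) ℂ) (x : ι → A) :
    matrixCoeffSum s (fun i => a i + b i) x = matrixCoeffSum s a x + matrixCoeffSum s b x := by
  ext p q
  simp [matrixCoeffSum, Finset.sum_add_distrib, add_smul]

/-- The chord of the unit circle with midpoint `z` has endpoints at angles `arg z ± arccos ‖z‖`. -/
theorem exists_unimodular_average {z : ℂ} (hz : ‖z‖ ≤ 1) :
    ∃ u v : ℂ, ‖u‖ = 1 ∧ ‖v‖ = 1 ∧ z = (2⁻¹ : ℂ) * (u + v) := by
  refine ⟨Complex.exp ((z.arg + Real.arccos ‖z‖ : ℝ) * Complex.I),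
    Complex.exp ((z.arg - Real.arccos ‖z‖ : ℝ) * Complex.I),
    Complex.norm_exp_ofReal_mul_I _, Complex.norm_exp_ofReal_mul_I _, ?_⟩
  have h1 : (‖z‖ : ℂ) = Complex.cos (Real.arccos ‖z‖ : ℝ) := by
    rw [← Complex.ofReal_cos, Real.cos_arccos (by linarith [norm_nonneg z]) hz]
  conv_lhs => rw [← Complex.norm_mul_exp_arg_mul_I z, h1, Complex.cos]
  push_cast
  rw [add_mul, sub_mul, Complex.exp_add, sub_eq_add_neg, Complex.exp_add, ← neg_mul]
  ring

/-- Coefficients that are bounded by `δ` act as a contraction, up to the factor `δ`, from the free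
unitaries to the unitaries of any group. -/
theorem norm_matrixCoeffSum_bounded_le (s : Finset ι) (a : ι → Matrix (Fin m) (Fin m) ℂ)
    (g : ι → G) {z : ι → ℂ} {δ : ℝ} (hδ : 0 < δ) (hz : ∀ i, ‖z i‖ ≤ δ) :
    ‖matrixCoeffSum s (fun i => z i • a i)
        (fun i => (GroupCStar.universalRep (g i) : GroupCStar G))‖ ≤
      δ * ‖matrixCoeffSum s a
        (fun i => (GroupCStar.universalRep (FreeGroup.of i) : GroupCStar (FreeGroup ι)))‖ := by
  have h1 : ∀ i, ∃ u v : ℂ, ‖u‖ = 1 ∧ ‖v‖ = 1 ∧ z i / δ = (2⁻¹ : ℂ) * (u + v) := fun i =>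
    exists_unimodular_average (by
      rw [norm_div, Complex.norm_real, Real.norm_of_nonneg hδ.le]
      exact div_le_one_of_le₀ (hz i) hδ.le)
  choose u v hu hv huv using h1
  have h2 : ∀ i, z i • a i = ((δ / 2 : ℝ) : ℂ) • (u i • a i + v i • a i) := fun i => by
    rw [← add_smul, smul_smul]
    congr 1
    have := huv i
    rw [div_eq_iff (by exact_mod_cast hδ.ne')] at this
    rw [this]; push_cast; ring
  simp only [h2]
  rw [matrixCoeffSum_smul, matrixCoeffSum_add, norm_smul, Complex.norm_real,
    Real.norm_of_nonneg (by positivity)]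
  have h3 := norm_matrixCoeffSum_unimodular_le s a g hu
  have h4 := norm_matrixCoeffSum_unimodular_le s a g hv
  refine (mul_le_mul_of_nonneg_left ((norm_add_le _ _).trans (add_le_add h3 h4))
    (by positivity)).trans ?_
  linarith

end FreeGroup

/-- Free groups are residually finite: finitely many nontrivial elements survive in a finite
permutation group. -/
theorem FreeGroup.exists_perm_ne_one {α : Type u} (S : Finset (FreeGroup α)) (hS : 1 ∉ S) :
    ∃ (V : Type u) (_ : Fintype V) (_ : DecidableEq V) (σ : FreeGroup α →* Equiv.Perm V),
      ∀ w ∈ S, σ w ≠ 1 := by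
  classical
  -- Left multiplication by a generator is a partial injection of the finite set `T` of suffixes and
  -- extends to a permutation. Building `w` from its last letter never leaves `T`, so `σ w` sends
  -- `1` to `w`.
  let T : Finset (FreeGroup α) := S.biUnion fun w => (w.toWord.tails.map FreeGroup.mk).toFinset
  have hT : ∀ w ∈ S, ∀ L, L <:+ w.toWord → FreeGroup.mk L ∈ T := fun w hw L hL => by
    simp only [T, Finset.mem_biUnion, List.mem_toFinset, List.mem_map, List.mem_tails]
    exact ⟨w, hw, L, hL, rfl⟩
  let e : ∀ a : α, {x : T // FreeGroup.of a * x.1 ∈ T} ≃ {y : T // (FreeGroup.of a)⁻¹ * y.1 ∈ T} :=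
    fun a =>
    { toFun := fun x => ⟨⟨FreeGroup.of a * x.1.1, x.2⟩, by simp⟩
      invFun := fun y => ⟨⟨(FreeGroup.of a)⁻¹ * y.1.1, y.2⟩, by simp⟩
      left_inv := fun x => by simp
      right_inv := fun y => by simp }
  let τ : α → Equiv.Perm T := fun a => (e a).extendSubtype
  have hτ : ∀ a (x : T), FreeGroup.of a * x.1 ∈ T → (τ a x).1 = FreeGroup.of a * x.1 :=
    fun a x h => congrArg Subtype.val ((e a).extendSubtype_apply_of_mem x h)
  have hτ' : ∀ a (x : T), (FreeGroup.of a)⁻¹ * x.1 ∈ T →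
      ((τ a)⁻¹ x).1 = (FreeGroup.of a)⁻¹ * x.1 := fun a x h => by
    have h1 : (τ a)⁻¹ x = ⟨(FreeGroup.of a)⁻¹ * x.1, h⟩ := by
      rw [Equiv.Perm.inv_eq_iff_eq]
      refine Subtype.ext ?_
      rw [hτ a _ (by simp)]
      simp
    rw [h1]
  let σ : FreeGroup α →* Equiv.Perm T := FreeGroup.lift τ
  have hσ : ∀ a, σ (FreeGroup.of a) = τ a := fun a => FreeGroup.lift_apply_of
  have key : ∀ (w) (hw : w ∈ S) (L : List (α × Bool)), L <:+ w.toWord →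
      (σ (FreeGroup.mk L) ⟨1, hT w hw [] (List.nil_suffix)⟩).1 = FreeGroup.mk L := by
    intro w hw L
    induction L with
    | nil => intro h; rw [← FreeGroup.one_eq_mk, _root_.map_one]; rfl
    | cons x L ih =>
      intro h
      have h' := ih ((List.suffix_cons x L).trans h)
      have h3 := hT w hw _ h
      obtain ⟨a, b⟩ := x
      cases b with
      | true =>
        have h1 : FreeGroup.mk ((a, true) :: L) = FreeGroup.of a * FreeGroup.mk L := by
          rw [FreeGroup.of, FreeGroup.mul_mk]; rfl
        rw [h1] at h3 ⊢
        rw [_root_.map_mul, Equiv.Perm.mul_apply, hσ, hτ _ _ (by rwa [h']), h']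
      | false =>
        have h1 : FreeGroup.mk ((a, false) :: L) = (FreeGroup.of a)⁻¹ * FreeGroup.mk L := by
          rw [FreeGroup.of, FreeGroup.inv_mk, FreeGroup.mul_mk]; rfl
        rw [h1] at h3 ⊢
        rw [_root_.map_mul, _root_.map_inv, Equiv.Perm.mul_apply, hσ, hτ' _ _ (by rwa [h']), h']
  refine ⟨T, inferInstance, inferInstance, σ, fun w hw h1 => ?_⟩
  have h2 := key w hw w.toWord (List.suffix_refl _)
  rw [FreeGroup.mk_toWord, h1, Equiv.Perm.one_apply] at h2
  have h3 : 1 = w := h2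
  exact hS (h3 ▸ hw)

/-! ### Positive definiteness of `r ^ |w|` on the free group. -/

section TreeKernel

variable {β : Type*}

/-- The distance of two words in the rooted tree of all words. -/
def treeDist [DecidableEq β] : List β → List β → ℕ
  | [], L => L.length
  | _ :: L, [] => L.length + 1
  | a :: L, b :: L' => if a = b then treeDist L L' else L.length + 1 + (L'.length + 1)

theorem posSemidef_of_forall_finset {X : Type*} {M : Matrix X X ℂ}
    (h : ∀ s : Finset X, ∃ N : Matrix X X ℂ, N.PosSemidef ∧ ∀ x ∈ s, ∀ y ∈ s, M x y = N x y) :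
    M.PosSemidef := by
  classical
  refine ⟨?_, fun c => ?_⟩
  · ext x y
    obtain ⟨N, hN, hMN⟩ := h {x, y}
    rw [Matrix.conjTranspose_apply, hMN y (by simp) x (by simp), hMN x (by simp) y (by simp)]
    exact hN.isHermitian.apply x y
  · obtain ⟨N, hN, hMN⟩ := h c.support
    convert hN.2 c using 1
    refine Finset.sum_congr rfl fun x hx => Finset.sum_congr rfl fun y hy => ?_
    dsimp only
    rw [hMN x hx y hy]

theorem posSemidef_star_mul {X : Type*} (f : X → ℂ) :
    (Matrix.of fun x y => star (f x) * f y).PosSemidef :=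
  posSemidef_of_inner_eq f fun x y => by simp [mul_comm]

/-- The part of the kernel `r ^ treeDist` orthogonal to the root, truncated at depth `N`. -/
noncomputable def treeKernel [DecidableEq β] (r : ℝ) : ℕ → Matrix (List β) (List β) ℂ
  | 0 => 0
  | N + 1 =>
    (((1 : Matrix (Option β) (Option β) ℂ).submatrix List.head? List.head?) ⊙
      (treeKernel r N + ((1 - r ^ 2 : ℝ) : ℂ) • Matrix.of fun L L' : List β =>
        star ((r : ℂ) ^ L.length) * (r : ℂ) ^ L'.length).submatrix List.tail List.tail) ⊙
      Matrix.of fun L L' : List β => star (if L = [] then (0 : ℂ) else 1) * if L' = [] then 0 else 1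

theorem posSemidef_treeKernel [DecidableEq β] {r : ℝ} (h0 : 0 ≤ r) (h1 : r ≤ 1) (N : ℕ) :
    (treeKernel (β := β) r N).PosSemidef := by
  induction N with
  | zero => exact Matrix.PosSemidef.zero
  | succ N ih =>
    have h2 : (0 : ℂ) ≤ ((1 - r ^ 2 : ℝ) : ℂ) := by
      exact_mod_cast sub_nonneg.mpr (pow_le_one₀ h0 h1)
    exact ((Matrix.PosSemidef.one.submatrix _).hadamard
      ((ih.add ((posSemidef_star_mul _).smul h2)).submatrix _)).hadamard (posSemidef_star_mul _)

/-- For equal heads, `r ^ 2 * r ^ (|L| + |L'|)` from the root and the weight `1 - r ^ 2` add up to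
the root term of the tails. For distinct heads the kernel vanishes and the geodesic passes through
the root. The recursion stops when either word is empty, so only one length needs a bound. -/
theorem treeKernel_add [DecidableEq β] (r : ℝ) (N : ℕ) (L L' : List β) (hL : L.length ≤ N) :
    treeKernel r N L L' + star ((r : ℂ) ^ L.length) * (r : ℂ) ^ L'.length =
      (r : ℂ) ^ treeDist L L' := by
  induction N generalizing L L' with
  | zero =>
    obtain rfl : L = [] := by simpa using hL
    simp [treeKernel, treeDist]
  | succ N ih =>
    rcases L with _ | ⟨a, L⟩
    · simp [treeKernel, treeDist]
    · rcases L' with _ | ⟨b, L'⟩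
      · simp [treeKernel, treeDist]
      · have := ih L L' (by simpa using hL)
        by_cases hab : a = b
        · subst hab
          simp only [treeKernel, treeDist, Matrix.hadamard_apply, Matrix.submatrix_apply,
            List.head?_cons, List.tail_cons, Matrix.one_apply, Matrix.add_apply,
            Matrix.smul_apply, Matrix.of_apply, if_true, ← this, List.length_cons]
          simp
          ring
        · simp [treeKernel, treeDist, hab, pow_add, Matrix.one_apply]

theorem posSemidef_pow_treeDist [DecidableEq β] {r : ℝ} (h0 : 0 ≤ r) (h1 : r ≤ 1) :
    (Matrix.of fun L L' : List β => (r : ℂ) ^ treeDist L L').PosSemidef := by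
  refine posSemidef_of_forall_finset fun s => ⟨_, (posSemidef_treeKernel h0 h1
    (s.sup List.length)).add (posSemidef_star_mul fun L => (r : ℂ) ^ L.length),
    fun L hL L' _ => ?_⟩
  rw [Matrix.add_apply, Matrix.of_apply, Matrix.of_apply]
  exact (treeKernel_add r _ L L' (Finset.le_sup hL)).symm

end TreeKernel

namespace FreeGroup

variable {α : Type*} [DecidableEq α]

/-- The Cayley graph is a tree: a common prefix cancels, and after the first differing letter the
concatenation is reduced. -/
theorem norm_inv_mul_mk (L L' : List (α × Bool)) (hL : IsReduced L) (hL' : IsReduced L') :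
    ((mk L)⁻¹ * mk L').norm = treeDist L L' := by
  induction L generalizing L' with
  | nil =>
    rw [← one_eq_mk, inv_one, one_mul, norm, toWord_mk, hL'.reduce_eq, treeDist]
  | cons a L ih =>
    rcases L' with _ | ⟨b, L'⟩
    · rw [← one_eq_mk, mul_one, norm_inv_eq, norm, toWord_mk, hL.reduce_eq, treeDist]
      rfl
    · rw [treeDist]
      split_ifs with hab
      · subst hab
        rw [← ih L' (List.IsChain.tail hL)
          (List.IsChain.tail hL')]
        have : ∀ K : List (α × Bool), mk (a :: K) = mk [a] * mk K := fun K => by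
          rw [mul_mk]; rfl
        rw [this L, this L']
        congr 1
        group
      · have h1 : IsReduced (invRev (a :: L)) := by
          rw [isReduced_iff_reduce_eq, reduce_invRev, hL.reduce_eq]
        have h2 : invRev (a :: L) = invRev L ++ [(a.1, !a.2)] := by simp [invRev]
        have h3 : IsReduced ([(a.1, !a.2)] ++ (b :: L')) := by
          rw [List.singleton_append, isReduced_cons_cons]
          refine ⟨fun h => ?_, hL'⟩
          by_contra hne
          refine hab (Prod.ext h ?_)
          revert hne
          cases a.2 <;> cases b.2 <;> simp
        rw [h2] at h1
        have h4 := h1.append_overlap h3 (by simp)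
        rw [inv_mk, mul_mk, norm, toWord_mk, h2, h4.reduce_eq]
        simp only [List.length_append, invRev_length, List.length_cons, List.length_nil]

/-- The function `r ^ |w|` on the free group, cut down to the words of degree `j - i` modulo `3`,
is positive definite. Its corner is close to a multiple of the indicator function of the set of
free generators. -/
theorem exists_posDefFun_generators {r : ℝ} (h0 : 0 ≤ r) (h1 : r ≤ 1) :
    ∃ θ : Fin 2 → Fin 2 → FreeGroup α → ℂ, IsPosDefFun θ ∧ (∀ i, θ i i 1 = 1) ∧
      (∀ t, θ 0 1 (of t) = r) ∧ ∀ w, w ∉ Set.range (of (α := α)) → ‖θ 0 1 w‖ ≤ r ^ 2 := by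
  -- The shift `c` makes the corner keep words of degree `1`. Modulus `3` is needed: modulo `2` the
  -- inverse generators would survive along with the generators.
  let d : FreeGroup α →* Multiplicative (ZMod 3) := lift fun _ => Multiplicative.ofAdd 1
  let c : Fin 2 → Multiplicative (ZMod 3) := ![Multiplicative.ofAdd 1, 1]
  have hd : IsPosDefFun fun (i j : Fin 2) (w : FreeGroup α) =>
      if c i = c j * d w then (1 : ℂ) else 0 := by
    have := (Matrix.PosSemidef.one (R := ℂ) (n := Multiplicative (ZMod 3))).submatrix
      fun x : FreeGroup α × Fin 2 => c x.2 * d x.1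
    unfold IsPosDefFun
    convert this using 1
    ext x y
    simp only [Matrix.of_apply, Matrix.submatrix_apply, Matrix.one_apply, _root_.map_mul, _root_.map_inv]
    congr 1
    rw [eq_iff_iff, ← mul_left_inj (d x.1), mul_assoc]
    simp [mul_comm]
  have hr : IsPosDefFun fun (i j : Fin 2) (w : FreeGroup α) => (r : ℂ) ^ w.norm := by
    have := (posSemidef_pow_treeDist (β := α × Bool) h0 h1).submatrix
      fun x : FreeGroup α × Fin 2 => x.1.toWord
    unfold IsPosDefFun
    convert this using 1
    ext x y
    simp only [Matrix.of_apply, Matrix.submatrix_apply]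
    rw [← norm_inv_mul_mk _ _ isReduced_toWord isReduced_toWord, mk_toWord, mk_toWord]
  refine ⟨_, hd.mul hr, fun i => by simp, fun t => ?_, fun w hw => ?_⟩
  · simp [d, c]
  · split_ifs with hcd
    · rw [one_mul, norm_pow, Complex.norm_real, Real.norm_of_nonneg h0]
      refine pow_le_pow_of_le_one h0 h1 ?_
      by_contra! hlt
      have hlen : w.toWord.length < 2 := hlt
      rw [← mk_toWord (x := w)] at hcd hw
      rcases hw' : w.toWord with _ | ⟨⟨a, b⟩, _ | ⟨_, _⟩⟩
      · rw [hw', ← one_eq_mk, _root_.map_one] at hcd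
        revert hcd; simp [c]
      · rw [hw'] at hcd hw
        cases b with
        | true => exact hw ⟨a, rfl⟩
        | false =>
          have : mk [(a, false)] = (of a)⁻¹ := by rw [of, inv_mk]; rfl
          rw [this, _root_.map_inv] at hcd
          revert hcd
          simp only [c, d, lift_apply_of]
          decide
      · rw [hw'] at hlen; simp at hlen
    · simp [sq_nonneg]

end FreeGroup

/-! ### Traciality on the group von Neumann algebra and summation over a factor. -/

section Orthogonal

variable {X H : Type*} [NormedAddCommGroup H] [InnerProductSpace ℂ H]

theorem norm_sq_sum_of_orthogonal (t : Finset X) (u : X → H)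
    (h : ∀ x ∈ t, ∀ y ∈ t, x ≠ y → inner ℂ (u x) (u y) = 0) :
    ‖∑ x ∈ t, u x‖ ^ 2 = ∑ x ∈ t, ‖u x‖ ^ 2 := by
  classical
  induction t using Finset.induction_on with
  | empty => simp
  | insert x t hx ih =>
    rw [Finset.sum_insert hx, Finset.sum_insert hx, norm_add_sq (𝕜 := ℂ), inner_sum,
      Finset.sum_eq_zero, ih]
    · simp
    · exact fun y hy z hz => h y (Finset.mem_insert_of_mem hy) z (Finset.mem_insert_of_mem hz)
    · intro y hy
      exact h x (Finset.mem_insert_self _ _) y (Finset.mem_insert_of_mem hy)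
        fun hxy => hx (hxy ▸ hy)

variable {F A E : Type*} [Fintype A] [NormedAddCommGroup E] [InnerProductSpace ℂ E]

/-- Pythagoras holds inside each block; Cauchy–Schwarz over the blocks costs the factor `card A`. -/
theorem norm_linearCombination_le_of_orthogonal {v : F × A → H} {D : ℝ}
    (hv : ∀ a w w', w ≠ w' → inner ℂ (v (w, a)) (v (w', a)) = 0) (hD : ∀ x, ‖v x‖ ^ 2 ≤ D)
    {e : F × A → E} (he : Orthonormal ℂ e) (c : F × A →₀ ℂ) :
    ‖Finsupp.linearCombination ℂ v c‖ ^ 2 ≤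
      Fintype.card A * D * ‖Finsupp.linearCombination ℂ e c‖ ^ 2 := by
  classical
  have h1 : ‖Finsupp.linearCombination ℂ e c‖ ^ 2 = ∑ x ∈ c.support, ‖c x‖ ^ 2 := by
    rw [Finsupp.linearCombination_apply, Finsupp.sum, norm_sq_sum_of_orthogonal]
    · simp [norm_smul, he.1]
    · intro x _ y _ hxy
      rw [inner_smul_left, inner_smul_right, he.2 hxy, mul_zero, mul_zero]
  have h2 : Finsupp.linearCombination ℂ v c =
      ∑ a, ∑ x ∈ c.support with x.2 = a, c x • v x := by
    rw [Finsupp.linearCombination_apply, Finsupp.sum]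
    exact (Finset.sum_fiberwise _ _ _).symm
  have h3 : ∀ a, ‖∑ x ∈ c.support with x.2 = a, c x • v x‖ ^ 2 ≤
      D * ∑ x ∈ c.support with x.2 = a, ‖c x‖ ^ 2 := fun a => by
    rw [norm_sq_sum_of_orthogonal, Finset.mul_sum]
    · refine Finset.sum_le_sum fun x _ => ?_
      rw [norm_smul, mul_pow, mul_comm]
      exact mul_le_mul_of_nonneg_right (hD x) (sq_nonneg _)
    · rintro ⟨w, b⟩ hx ⟨w', b'⟩ hy hxy
      obtain rfl : b = a := (Finset.mem_filter.mp hx).2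
      obtain rfl : b' = b := (Finset.mem_filter.mp hy).2
      rw [inner_smul_left, inner_smul_right, hv, mul_zero, mul_zero]
      rintro rfl
      exact hxy rfl
  calc ‖Finsupp.linearCombination ℂ v c‖ ^ 2
      ≤ (∑ a, ‖∑ x ∈ c.support with x.2 = a, c x • v x‖) ^ 2 := by
        rw [h2]; gcongr; exact norm_sum_le _ _
    _ ≤ Fintype.card A * ∑ a, ‖∑ x ∈ c.support with x.2 = a, c x • v x‖ ^ 2 :=
        sq_sum_le_card_mul_sum_sq
    _ ≤ Fintype.card A * ∑ a, D * ∑ x ∈ c.support with x.2 = a, ‖c x‖ ^ 2 := by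
        gcongr with a _; exact h3 a
    _ = _ := by
        rw [← Finset.mul_sum, h1, mul_assoc]
        congr 2
        exact Finset.sum_fiberwise _ _ _

end Orthogonal

/-- A positive semidefinite kernel that is diagonal on each block defines a bounded positive
operator. -/
theorem exists_positive_operator {F A : Type u} [Fintype A] {E : Type*}
    [NormedAddCommGroup E] [InnerProductSpace ℂ E] [CompleteSpace E] {e : F × A → E}
    (he : Orthonormal ℂ e) (hd : DenseRange (Finsupp.linearCombination ℂ e))
    {K : Matrix (F × A) (F × A) ℂ} (hK : K.PosSemidef) {D : ℝ}
    (h0 : ∀ a w w', w ≠ w' → K (w, a) (w', a) = 0) (hD : ∀ x, K x x ≤ D) :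
    ∃ P : E →L[ℂ] E, 0 ≤ P ∧ ∀ x y, inner ℂ (e x) (P (e y)) = K x y := by
  obtain ⟨H, _, _, _, v, hv, -⟩ := hK.exists_vectors
  have hb : ∀ c, ‖Finsupp.linearCombination ℂ v c‖ ≤
      √(Fintype.card A * D) * ‖Finsupp.linearCombination ℂ e c‖ := fun c => by
    have h1 := norm_linearCombination_le_of_orthogonal (v := v) (D := D)
      (fun a w w' hw => by rw [hv, h0 a w w' hw]) (fun x => by
        have := hD x
        rw [← hv, inner_self_eq_norm_sq_to_K] at this
        have h2 : ((‖v x‖ ^ 2 : ℝ) : ℂ) ≤ D := by push_cast; exact this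
        exact_mod_cast h2) he c
    have h2 := Real.sqrt_le_sqrt h1
    rwa [Real.sqrt_sq (norm_nonneg _), Real.sqrt_mul' _ (sq_nonneg _),
      Real.sqrt_sq (norm_nonneg _)] at h2
  let W : E →L[ℂ] H :=
    (Finsupp.linearCombination ℂ v).extendOfNorm (Finsupp.linearCombination ℂ e)
  have hW : ∀ x, W (e x) = v x := fun x => by
    simpa using LinearMap.extendOfNorm_eq (f := Finsupp.linearCombination ℂ v) hd ⟨_, hb⟩
      (Finsupp.single x 1)
  refine ⟨ContinuousLinearMap.adjoint W ∘L W, ?_, fun x y => ?_⟩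
  · rw [ContinuousLinearMap.nonneg_iff_isPositive]
    exact ContinuousLinearMap.isPositive_adjoint_comp_self W
  · rw [ContinuousLinearMap.comp_apply, ContinuousLinearMap.adjoint_inner_right, hW, hW, hv]

theorem tsum_prod_fintype {F A : Type*} [Fintype A] {f : F × A → ℂ} (hf : Summable f) :
    ∑' x, f x = ∑ a, ∑' w, f (w, a) := by
  have h1 := (Equiv.prodComm A F).tsum_eq f
  have h2 : Summable fun x : A × F => f (Equiv.prodComm A F x) :=
    (Equiv.prodComm A F).summable_iff.mpr hf
  rw [← h1, h2.tsum_prod, tsum_fintype]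
  rfl

/-- Traciality of the canonical trace, in the form of positivity of the trace of a product of two
positive elements of the von Neumann algebra of a group. -/
theorem IsPosDefFun.trace_nonneg {F A : Type u} [Group F] [Fintype A]
    {κ κ' : A → A → F → ℂ} (hκ : IsPosDefFun κ) (hκ' : IsPosDefFun κ')
    (h0 : ∀ a w, w ≠ 1 → κ a a w = 0) (h0' : ∀ a w, w ≠ 1 → κ' a a w = 0) :
    0 ≤ ∑ a, ∑ b, ∑' w, κ a b w * star (κ' a b w) := by
  classical
  let _ : MulAction F (F × A) :=
    { smul := fun g x => (g * x.1, x.2)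
      one_smul := fun x => Prod.ext (one_mul _) rfl
      mul_smul := fun g h x => Prod.ext (mul_assoc _ _ _) rfl }
  have hs : ∀ (g : F) (x : F × A), g • x = (g * x.1, x.2) := fun _ _ => rfl
  obtain ⟨E, _, _, _, e, ρ, he1, hd, hρ⟩ :=
    Matrix.PosSemidef.exists_unitary (Γ := F) (Matrix.PosSemidef.one (n := F × A) (R := ℂ))
      fun g x y => by simp [Matrix.one_apply, hs, Prod.ext_iff]
  have he : Orthonormal ℂ e := orthonormal_iff_ite.mpr fun x y => by
    rw [he1, Matrix.one_apply]
  let b : HilbertBasis (F × A) ℂ E := HilbertBasis.mk he (by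
    rw [← Finsupp.range_linearCombination]
    intro x _
    exact hd x)
  have hb : ∀ x, b x = e x := fun x => by rw [HilbertBasis.coe_mk]
  -- The diagonal condition serves only to make the convolution operator bounded.
  have hop : ∀ {k : A → A → F → ℂ}, IsPosDefFun k → (∀ a w, w ≠ 1 → k a a w = 0) →
      ∃ P : E →L[ℂ] E, 0 ≤ P ∧
        ∀ x y : F × A, inner ℂ (e x) (P (e y)) = k x.2 y.2 (x.1⁻¹ * y.1) := by
    intro k hk hk0
    have hdiag : ∀ a, k a a 1 ≤ ((∑ a, ‖k a a 1‖ : ℝ) : ℂ) := fun a => by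
      have hp : 0 ≤ k a a 1 := by simpa using Matrix.PosSemidef.diag_nonneg hk (i := (1, a))
      rw [← Complex.norm_of_nonneg' hp]
      exact_mod_cast Finset.single_le_sum (f := fun a => ‖k a a 1‖)
        (fun _ _ => norm_nonneg _) (Finset.mem_univ a)
    exact exists_positive_operator he hd hk (D := ∑ a, ‖k a a 1‖)
      (fun a w w' hw => hk0 a _ fun h => hw (inv_mul_eq_one.mp h))
      (fun x => by simpa using hdiag x.2)
  obtain ⟨P, hP, hPe⟩ := hop hκ h0
  obtain ⟨Q, hQ, hQe⟩ := hop hκ' h0'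
  have hPsa : ∀ x y, inner ℂ (P x) y = inner ℂ x (P y) :=
    ((ContinuousLinearMap.nonneg_iff_isPositive P).mp hP).isSymmetric
  have hQsa : ∀ x y, inner ℂ (Q x) y = inner ℂ x (Q y) :=
    ((ContinuousLinearMap.nonneg_iff_isPositive Q).mp hQ).isSymmetric
  have hcomm : ∀ {k : A → A → F → ℂ} {T : E →L[ℂ] E},
      (∀ x y : F × A, inner ℂ (e x) (T (e y)) = k x.2 y.2 (x.1⁻¹ * y.1)) →
      ∀ g, Commute T (ρ g : E →L[ℂ] E) := by
    intro k T hT g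
    refine clm_ext_of_dense hd fun y => ?_
    have h2 : innerSL ℂ (T (e (g • y))) = innerSL ℂ ((ρ g : E →L[ℂ] E) (T (e y))) := by
      refine clm_ext_of_dense hd fun x => ?_
      rw [innerSL_apply_apply, innerSL_apply_apply, ← inner_conj_symm, hT,
        ← ContinuousLinearMap.adjoint_inner_right, ← ContinuousLinearMap.star_eq_adjoint,
        ← Unitary.coe_star, Unitary.star_eq_inv, ← map_inv, hρ, ← inner_conj_symm, hT, hs, hs]
      simp [mul_assoc]
    rw [mul_apply_eq_comp, mul_apply_eq_comp, hρ]
    refine ext_inner_right ℂ fun z => ?_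
    simpa using congrArg (fun f => f z) h2
  -- The trace of `P * Q` is rewritten as that of `R * P * R`. As `R` commutes with translations,
  -- `hterm` can exchange the two factors by `w ↦ w⁻¹` and a swap of indices; this is traciality.
  let R : E →L[ℂ] E := CFC.sqrt Q
  have hR : 0 ≤ R := CFC.sqrt_nonneg Q
  have hRR : R * R = Q := CFC.sqrt_mul_sqrt_self Q hQ
  have hRsa : ∀ x y, inner ℂ (R x) y = inner ℂ x (R y) :=
    ((ContinuousLinearMap.nonneg_iff_isPositive R).mp hR).isSymmetric
  have hRc : ∀ g, Commute R (ρ g : E →L[ℂ] E) := fun g => (hcomm hQe g).cfcₙ_nnreal _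
  have hRP : ∀ g, Commute (R * P) (ρ g : E →L[ℂ] E) := fun g => (hRc g).mul_left (hcomm hPe g)
  have hinv : ∀ {T : E →L[ℂ] E}, (∀ g, Commute T (ρ g : E →L[ℂ] E)) → ∀ a c w,
      inner ℂ (e (w, c)) (T (e (1, a))) = inner ℂ (e (1, c)) (T (e (w⁻¹, a))) := by
    intro T hT a c w
    have h1 : e (w⁻¹, a) = (ρ w⁻¹ : E →L[ℂ] E) (e (1, a)) := by rw [hρ, hs, mul_one]
    have h2 : e (w, c) = (ρ w : E →L[ℂ] E) (e (1, c)) := by rw [hρ, hs, mul_one]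
    have h3 := congrArg (fun S : E →L[ℂ] E => S (e (1, a))) (hT w⁻¹)
    simp only [mul_apply_eq_comp] at h3
    rw [h1, h3, h2, map_inv, ← Unitary.star_eq_inv, Unitary.coe_star,
      ContinuousLinearMap.star_eq_adjoint, ContinuousLinearMap.adjoint_inner_right]
  have hexp : ∀ x y : E, inner ℂ x y =
      ∑ c, ∑' w, inner ℂ x (e (w, c)) * inner ℂ (e (w, c)) y := fun x y => by
    have h1 := b.summable_inner_mul_inner x y
    rw [← b.tsum_inner_mul_inner, tsum_prod_fintype h1]
    simp only [hb]
  have hS : ∀ a, ∑ c, ∑' w, κ a c w * star (κ' a c w) =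
      inner ℂ ((R * P) (e (1, a))) (R (e (1, a))) := fun a => by
    have h1 : inner ℂ ((R * P) (e (1, a))) (R (e (1, a))) =
        inner ℂ (P (e (1, a))) (Q (e (1, a))) := by
      rw [mul_apply_eq_comp, hRsa, ← mul_apply_eq_comp, hRR]
    rw [h1, hexp]
    refine Finset.sum_congr rfl fun c _ => tsum_congr fun w => ?_
    rw [hPsa, hPe, ← inner_conj_symm (e (w, c)), hQsa, hQe]
    simp
  have hterm : ∀ a, inner ℂ ((R * P) (e (1, a))) (R (e (1, a))) =
      ∑ c, ∑' w, inner ℂ (R (e (1, c))) (e (w, a)) * inner ℂ (e (w, a)) (P (R (e (1, c)))) := by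
    intro a
    rw [hexp]
    refine Finset.sum_congr rfl fun c _ => ?_
    rw [← (Equiv.inv F).tsum_eq]
    refine tsum_congr fun w => ?_
    rw [Equiv.inv_apply, ← inner_conj_symm, hinv hRP, hinv hRc, inv_inv, inner_conj_symm,
      mul_apply_eq_comp, hRsa, hPsa, ← hRsa (e (1, c)), mul_comm]
  simp only [hS, hterm]
  rw [Finset.sum_comm]
  refine Finset.sum_nonneg fun c _ => ?_
  rw [← hexp]
  exact ((ContinuousLinearMap.nonneg_iff_isPositive P).mp hP).inner_nonneg_right _

theorem posSemidef_congr {X : Type*} {M N : Matrix X X ℂ} (hM : M.PosSemidef)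
    (h : ∀ x y, N x y = M x y) : N.PosSemidef := by
  rwa [Matrix.ext h]

/-- Summation of the product of two positive definite functions over the second factor. -/
theorem IsPosDefFun.tsum_mul_star {G F : Type u} {J : Type} [Group G] [Group F]
    {s s' : J → J → G × F → ℂ} (hs : IsPosDefFun s) (hs' : IsPosDefFun s')
    (h0 : ∀ i w, w ≠ 1 → s i i (1, w) = 0) (h0' : ∀ i w, w ≠ 1 → s' i i (1, w) = 0) :
    IsPosDefFun fun i j γ => ∑' w, s i j (γ, w) * star (s' i j (γ, w)) := by
  refine ⟨?_, fun c => ?_⟩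
  · ext x y
    rw [Matrix.conjTranspose_apply, Matrix.of_apply, Matrix.of_apply, RCLike.star_def,
      Complex.conj_tsum, ← (Equiv.inv F).tsum_eq]
    refine tsum_congr fun w => ?_
    rw [map_mul, ← RCLike.star_def, star_star, Equiv.inv_apply, hs.star_apply,
      hs'.star_apply]
    simp
  -- The quadratic form at `c` is a trace pairing over `F` with matrix indices in the support of
  -- `c`; the coefficients are absorbed into the first factor.
  · have hκ : IsPosDefFun fun (a b : c.support) (w : F) =>
        star (c a) * c b * s a.1.2 b.1.2 (a.1.1⁻¹ * b.1.1, w) := by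
      have h1 := (Matrix.PosSemidef.submatrix hs fun x : F × c.support =>
        ((x.2.1.1, x.1), x.2.1.2)).hadamard (posSemidef_star_mul fun x : F × c.support => c x.2)
      refine posSemidef_congr h1 fun x y => ?_
      simp
      ring
    have hκ' : IsPosDefFun fun (a b : c.support) (w : F) =>
        s' a.1.2 b.1.2 (a.1.1⁻¹ * b.1.1, w) :=
      Matrix.PosSemidef.submatrix hs' fun x : F × c.support => ((x.2.1.1, x.1), x.2.1.2)
    have key := hκ.trace_nonneg hκ' (fun a w hw => by simp [h0 _ w hw])
      (fun a w hw => by simp [h0' _ w hw])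
    convert key using 1
    simp only [Finsupp.sum, Matrix.of_apply]
    rw [← Finset.sum_coe_sort]
    refine Finset.sum_congr rfl fun a _ => ?_
    rw [← Finset.sum_coe_sort]
    refine Finset.sum_congr rfl fun b _ => ?_
    rw [mul_right_comm, ← tsum_mul_left]
    refine tsum_congr fun w => ?_
    ring

/-- Bessel's inequality for a positive definite function whose restriction to the second factor is
a multiple of the Dirac function. -/
theorem IsPosDefFun.sum_norm_sq_le {G F : Type u} {J : Type} [Group G] [Group F]
    {s : J → J → G × F → ℂ} (hs : IsPosDefFun s) {C : ℝ} (hC : 0 < C)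
    (h0 : ∀ i w, w ≠ 1 → s i i (1, w) = 0) (h1 : ∀ i, s i i 1 = C) (i j : J) (γ : G)
    (T : Finset F) : ∑ w ∈ T, ‖s i j (γ, w)‖ ^ 2 ≤ C ^ 2 := by
  obtain ⟨H, _, _, _, v, hv, -⟩ := Matrix.PosSemidef.exists_vectors hs
  have hn : ∀ x : (G × F) × J, ‖v x‖ ^ 2 = C := fun x => by
    have h2 := hv x x
    rw [inner_self_eq_norm_sq_to_K, Matrix.of_apply, inv_mul_cancel, h1] at h2
    have h3 : ((‖v x‖ ^ 2 : ℝ) : ℂ) = C := by push_cast; exact h2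
    exact_mod_cast h3
  -- Bessel's inequality is applied to `v ((1, 1), i)`, of squared norm `C`; normalising the
  -- orthogonal family costs the other factor `C`.
  have ho : Orthonormal ℂ fun w : F => ((√C)⁻¹ : ℂ) • v ((γ, w), j) := by
    refine ⟨fun w => ?_, fun w w' hw => ?_⟩
    · rw [norm_smul, norm_inv, Complex.norm_real, Real.norm_of_nonneg (Real.sqrt_nonneg _),
        ← hn ((γ, w), j), Real.sqrt_sq (norm_nonneg _)]
      refine inv_mul_cancel₀ fun h => hC.ne' ?_
      rw [← hn ((γ, w), j), h]; simp
    · beta_reduce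
      rw [inner_smul_left, inner_smul_right, hv]
      have : w⁻¹ * w' ≠ 1 := fun h => hw (inv_mul_eq_one.mp h)
      simp [h0 j _ this]
  have hb := ho.sum_inner_products_le (v ((1, 1), i)) (s := T)
  have h3 : ∀ w, ‖inner ℂ (((√C)⁻¹ : ℂ) • v ((γ, w), j)) (v ((1, 1), i))‖ ^ 2 =
      C⁻¹ * ‖s i j (γ, w)‖ ^ 2 := fun w => by
    rw [norm_inner_symm, inner_smul_right, norm_mul, mul_pow, hv, norm_inv, Complex.norm_real,
      Real.norm_of_nonneg (Real.sqrt_nonneg _), inv_pow, Real.sq_sqrt hC.le]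
    simp
  simp only [h3, hn] at hb
  rw [← Finset.mul_sum, inv_mul_le_iff₀ hC] at hb
  rwa [sq]

/-! ### From the Sidon norm inequality to positivity on an operator system. -/

section SidonForm

variable {G ι : Type u} [Group G]

theorem UnitaryRep.coeffForm_reindex {n n' : Type*} [Fintype n] [Fintype n'] (e : n ≃ n')
    (π : UnitaryRep G) {ι : Type*} (s : Finset ι) (a : ι → Matrix n n ℂ) (g : ι → G)
    (ξ η : n' → π.H) :
    π.coeffForm s (fun i => (a i).reindex e e) g ξ η = π.coeffForm s a g (ξ ∘ e) (η ∘ e) := by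
  unfold UnitaryRep.coeffForm
  rw [← e.sum_comp]
  refine Finset.sum_congr rfl fun p _ => ?_
  rw [← e.sum_comp]
  simp

/-- The inequality defining completely Sidon families, with constant `C`, in terms of the
sesquilinear forms in all representations, for coefficients indexed by any finite type. -/
theorem norm_coeffForm_le_of_sidon {g : ι → G} {C : ℝ} (hC : 0 ≤ C)
    (hS : ∀ (m : ℕ) (s : Finset ι) (a : ι → Matrix (Fin m) (Fin m) ℂ),
      ‖matrixCoeffSum s a
        (fun i => (GroupCStar.universalRep (FreeGroup.of i) : GroupCStar (FreeGroup ι)))‖ ≤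
      C * ‖matrixCoeffSum s a (fun i => (GroupCStar.universalRep (g i) : GroupCStar G))‖)
    {n : Type*} [Fintype n] (s : Finset ι) (a : ι → Matrix n n ℂ) {R : ℝ} (hR : 0 ≤ R)
    (h : ∀ (π : UnitaryRep G) (ξ η : n → π.H), ‖π.coeffForm s a g ξ η‖ ≤
      R * (((∑ p, ‖ξ p‖ ^ 2) + ∑ q, ‖η q‖ ^ 2) / 2))
    (σ : UnitaryRep (FreeGroup ι)) (ξ η : n → σ.H) :
    ‖σ.coeffForm s a FreeGroup.of ξ η‖ ≤
      C * R * (((∑ p, ‖ξ p‖ ^ 2) + ∑ q, ‖η q‖ ^ 2) / 2) := by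
  let e := Fintype.equivFin n
  have h1 : ‖matrixCoeffSum s (fun i => (a i).reindex e e)
      (fun i => (GroupCStar.universalRep (g i) : GroupCStar G))‖ ≤ R := by
    rw [norm_matrixCoeffSum_le_iff _ _ _ hR]
    intro π ξ η
    rw [UnitaryRep.coeffForm_reindex, ← e.sum_comp, ← e.sum_comp fun q => ‖η q‖ ^ 2]
    exact h π _ _
  have h2 := (hS _ s fun i => (a i).reindex e e).trans (mul_le_mul_of_nonneg_left h1 hC)
  rw [norm_matrixCoeffSum_le_iff _ _ _ (mul_nonneg hC hR)] at h2
  have h3 := h2 σ (ξ ∘ e.symm) (η ∘ e.symm)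
  rw [UnitaryRep.coeffForm_reindex] at h3
  have h4 : ∀ ζ : n → σ.H, ∑ p, ‖(ζ ∘ e.symm) p‖ ^ 2 = ∑ p, ‖ζ p‖ ^ 2 := fun ζ =>
    e.symm.sum_comp fun p => ‖ζ p‖ ^ 2
  rw [h4, h4] at h3
  simpa [Function.comp_def] using h3

end SidonForm

section MatrixForms

variable {n H : Type*} [Fintype n] [NormedAddCommGroup H] [InnerProductSpace ℂ H]

/-- The quadratic form of `A ⊗ 1` on `H^n`. -/
noncomputable def matrixForm (A : Matrix n n ℂ) (ζ : n → H) : ℂ :=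
  ∑ p, ∑ q, A p q * inner ℂ (ζ p) (ζ q)

/-- The action of a scalar matrix on `H^n`. -/
def matrixAct (S : Matrix n n ℂ) (ζ : n → H) : n → H := fun p => ∑ q, S p q • ζ q

theorem matrixAct_mul (S T : Matrix n n ℂ) (ζ : n → H) :
    matrixAct S (matrixAct T ζ) = matrixAct (S * T) ζ := by
  funext p
  simp only [matrixAct, Finset.smul_sum, Matrix.mul_apply, Finset.sum_smul, smul_smul]
  rw [Finset.sum_comm]

theorem matrixAct_one [DecidableEq n] (ζ : n → H) : matrixAct (1 : Matrix n n ℂ) ζ = ζ := by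
  funext p
  simp [matrixAct, Matrix.one_apply]

theorem sum_comm_three {f : n → n → n → ℂ} :
    ∑ p, ∑ q, ∑ r, f p q r = ∑ r, ∑ q, ∑ p, f p q r := by
  rw [Finset.sum_comm, Finset.sum_congr rfl fun q _ => Finset.sum_comm, Finset.sum_comm]

theorem sum_inner_matrixAct (S T a : Matrix n n ℂ) (ζ ζ' : n → H) (V : H →L[ℂ] H) :
    ∑ p, ∑ q, a p q * inner ℂ (matrixAct S ζ p) (V (matrixAct T ζ' q)) =
      ∑ p, ∑ q, (Sᴴ * a * T) p q * inner ℂ (ζ p) (V (ζ' q)) := by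
  simp only [matrixAct, map_sum, map_smul, sum_inner, inner_sum, inner_smul_left,
    inner_smul_right, Matrix.mul_apply, Matrix.conjTranspose_apply, Finset.mul_sum,
    Finset.sum_mul]
  calc _ = ∑ p, ∑ q, ∑ r, ∑ s, a p q * (T q r * ((starRingEnd ℂ) (S p s) *
        inner ℂ (ζ s) (V (ζ' r)))) := rfl
    _ = ∑ s, ∑ r, ∑ q, ∑ p, a p q * (T q r * ((starRingEnd ℂ) (S p s) *
        inner ℂ (ζ s) (V (ζ' r)))) := by
      rw [Finset.sum_congr rfl fun p _ => sum_comm_three, Finset.sum_comm]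
      refine Finset.sum_congr rfl fun s _ => ?_
      rw [Finset.sum_comm]
      refine Finset.sum_congr rfl fun r _ => ?_
      rw [Finset.sum_comm]
    _ = _ := by
      refine Finset.sum_congr rfl fun s _ => Finset.sum_congr rfl fun r _ =>
        Finset.sum_congr rfl fun q _ => Finset.sum_congr rfl fun p _ => ?_
      rw [RCLike.star_def]; ring

theorem matrixForm_conjTranspose_mul_self (S : Matrix n n ℂ) (ζ : n → H) :
    matrixForm (Sᴴ * S) ζ = ((∑ p, ‖matrixAct S ζ p‖ ^ 2 : ℝ) : ℂ) := by
  classical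
  have := sum_inner_matrixAct S S 1 ζ ζ (ContinuousLinearMap.id ℂ H)
  simp only [mul_one, ContinuousLinearMap.id_apply] at this
  rw [matrixForm, ← this]
  simp [Matrix.one_apply]

/-- The real part of the form sees only the Hermitian part of `A`; the `δ` term will make it
invertible. -/
theorem re_matrixForm_add (A : Matrix n n ℂ) [DecidableEq n] (δ : ℝ) (ζ : n → H) :
    matrixForm ((2⁻¹ : ℂ) • (A + Aᴴ) + (δ : ℂ) • 1) ζ =
      (((matrixForm A ζ).re + δ * ∑ p, ‖ζ p‖ ^ 2 : ℝ) : ℂ) := by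
  have h1 : matrixForm Aᴴ ζ = star (matrixForm A ζ) := by
    simp only [matrixForm, star_sum, star_mul', RCLike.star_def, inner_conj_symm,
      Matrix.conjTranspose_apply]
    rw [Finset.sum_comm]
  have h2 : matrixForm (1 : Matrix n n ℂ) ζ = ((∑ p, ‖ζ p‖ ^ 2 : ℝ) : ℂ) := by
    simp [matrixForm, Matrix.one_apply]
  have h3 : matrixForm ((2⁻¹ : ℂ) • (A + Aᴴ) + (δ : ℂ) • 1) ζ =
      2⁻¹ * (matrixForm A ζ + matrixForm Aᴴ ζ) + δ * matrixForm 1 ζ := by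
    simp only [matrixForm, Finset.mul_sum, ← Finset.sum_add_distrib, Matrix.add_apply,
      Matrix.smul_apply, smul_eq_mul]
    refine Finset.sum_congr rfl fun p _ => Finset.sum_congr rfl fun q _ => ?_
    ring
  rw [h3, h1, h2]
  have h4 : (2⁻¹ : ℂ) * (matrixForm A ζ + star (matrixForm A ζ)) = ((matrixForm A ζ).re : ℂ) := by
    rw [RCLike.star_def, Complex.add_conj]; push_cast; ring
  rw [h4]; push_cast; ring

theorem matrixForm_smul (A : Matrix n n ℂ) (c : n → ℂ) (h : H) :
    matrixForm A (fun p => c p • h) = star c ⬝ᵥ (A *ᵥ c) * (‖h‖ : ℂ) ^ 2 := by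
  simp only [matrixForm, inner_smul_left, inner_smul_right, dotProduct, Matrix.mulVec,
    Finset.mul_sum, Finset.sum_mul, Pi.star_apply, inner_self_eq_norm_sq_to_K]
  refine Finset.sum_congr rfl fun p _ => Finset.sum_congr rfl fun q _ => ?_
  rw [RCLike.star_def]
  simp only [Complex.coe_algebraMap]
  ring

end MatrixForms

section OperatorSystem

variable {G ι : Type u} [Group G]

theorem UnitaryRep.coeffForm_matrixAct {n ι : Type*} [Fintype n] (π : UnitaryRep G)
    (s : Finset ι) (a : ι → Matrix n n ℂ) (g : ι → G) (S T : Matrix n n ℂ) (ξ η : n → π.H) :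
    π.coeffForm s a g (matrixAct S ξ) (matrixAct T η) =
      π.coeffForm s (fun i => Sᴴ * a i * T) g ξ η := by
  have h : ∀ (b : ι → Matrix n n ℂ) (ξ η : n → π.H), π.coeffForm s b g ξ η =
      ∑ i ∈ s, ∑ p, ∑ q, b i p q * inner ℂ (ξ p) ((π.hom (g i) : π.H →L[ℂ] π.H) (η q)) := by
    intro b ξ η
    unfold UnitaryRep.coeffForm
    rw [Finset.sum_comm (s := s)]
    exact Finset.sum_congr rfl fun p _ => Finset.sum_comm
  rw [h, h]
  exact Finset.sum_congr rfl fun i _ => sum_inner_matrixAct S T (a i) ξ η _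

theorem UnitaryRep.coeffForm_smul_right {n ι : Type*} [Fintype n] (π : UnitaryRep G)
    (s : Finset ι) (a : ι → Matrix n n ℂ) (g : ι → G) (c : ℂ) (ξ η : n → π.H) :
    π.coeffForm s a g ξ (fun q => c • η q) = c * π.coeffForm s a g ξ η := by
  simp only [UnitaryRep.coeffForm, map_smul, inner_smul_right, Finset.mul_sum]
  refine Finset.sum_congr rfl fun p _ => Finset.sum_congr rfl fun q _ =>
    Finset.sum_congr rfl fun i _ => ?_
  ring

theorem UnitaryRep.coeffForm_zero_right {n ι : Type*} [Fintype n] (π : UnitaryRep G)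
    (s : Finset ι) (a : ι → Matrix n n ℂ) (g : ι → G) (ξ : n → π.H) :
    π.coeffForm s a g ξ 0 = 0 := by
  simp [UnitaryRep.coeffForm]

theorem UnitaryRep.coeffForm_zero_left {n ι : Type*} [Fintype n] (π : UnitaryRep G)
    (s : Finset ι) (a : ι → Matrix n n ℂ) (g : ι → G) (η : n → π.H) :
    π.coeffForm s a g 0 η = 0 := by
  simp [UnitaryRep.coeffForm]

/-- The trivial representation on a one-dimensional space. -/
noncomputable def trivialRep (G : Type u) [Group G] : UnitaryRep G :=
  UnitaryRep.mk (EuclideanSpace ℂ PUnit.{u + 1}) 1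

/-- A matrix whose form has nonnegative real part is, up to a small multiple of the identity and an
antihermitian part, of the form `Sᴴ * S` with `S` invertible. -/
theorem exists_factorization {n : Type*} [Fintype n] [DecidableEq n] (A : Matrix n n ℂ)
    (hA : ∀ c : n → ℂ, 0 ≤ (star c ⬝ᵥ (A *ᵥ c)).re) {δ : ℝ} (hδ : 0 < δ) :
    ∃ S : Matrix n n ℂ, IsUnit S ∧ Sᴴ * S = (2⁻¹ : ℂ) • (A + Aᴴ) + (δ : ℂ) • 1 := by
  have h1 : ((2⁻¹ : ℂ) • (A + Aᴴ) + (δ : ℂ) • 1).PosDef := by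
    refine Matrix.PosDef.of_dotProduct_mulVec_pos ?_ fun c hc => ?_
    · simp [Matrix.IsHermitian, Matrix.conjTranspose_add, Matrix.conjTranspose_smul, add_comm]
    · have h2 := re_matrixForm_add A δ (fun p => c p • (1 : ℂ))
      rw [matrixForm_smul, matrixForm_smul] at h2
      simp only [norm_one, Complex.ofReal_one, one_pow, mul_one, smul_eq_mul] at h2
      rw [h2]
      have h3 : 0 < ∑ p, ‖c p‖ ^ 2 := by
        obtain ⟨p, hp⟩ := Function.ne_iff.mp hc
        refine Finset.sum_pos' (fun _ _ => sq_nonneg _) ⟨p, Finset.mem_univ _, ?_⟩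
        have : 0 < ‖c p‖ := norm_pos_iff.mpr hp
        positivity
      have h4 := hA c
      have : 0 < (star c ⬝ᵥ A *ᵥ c).re + δ * ∑ p, ‖c p‖ ^ 2 := by positivity
      exact_mod_cast this
  open scoped MatrixOrder in
  obtain ⟨S, hS⟩ := CStarAlgebra.nonneg_iff_eq_star_mul_self.mp h1.posSemidef.nonneg
  refine ⟨S, ?_, hS.symm⟩
  have h2 : IsUnit (star S * S) := hS ▸ h1.isUnit
  rw [Matrix.isUnit_iff_isUnit_det, Matrix.det_mul] at h2
  exact (Matrix.isUnit_iff_isUnit_det _).mpr (isUnit_of_mul_isUnit_right h2)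

/-- A positivity property of an operator system in `M_2(M_n(C*(G)))` passes, up to the Sidon
constant, to the corresponding operator system of the free group. -/
theorem re_coeffForm_nonneg_of_sidon {g : ι → G} {C : ℝ} (hC : 0 ≤ C)
    (hS : ∀ (m : ℕ) (s : Finset ι) (a : ι → Matrix (Fin m) (Fin m) ℂ),
      ‖matrixCoeffSum s a
        (fun i => (GroupCStar.universalRep (FreeGroup.of i) : GroupCStar (FreeGroup ι)))‖ ≤
      C * ‖matrixCoeffSum s a (fun i => (GroupCStar.universalRep (g i) : GroupCStar G))‖)
    {n : Type*} [Fintype n] (s : Finset ι) (a : ι → Matrix n n ℂ) (A B : Matrix n n ℂ)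
    (h : ∀ (π : UnitaryRep G) (ξ η : n → π.H),
      0 ≤ (matrixForm A ξ).re + (matrixForm B η).re + (π.coeffForm s a g ξ η).re)
    (σ : UnitaryRep (FreeGroup ι)) (ξ η : n → σ.H) :
    0 ≤ C * (matrixForm A ξ).re + C * (matrixForm B η).re +
      (σ.coeffForm s a FreeGroup.of ξ η).re := by
  classical
  have hform0 : ∀ (D : Matrix n n ℂ) (π : UnitaryRep G), matrixForm D (0 : n → π.H) = 0 :=
    fun D π => by simp [matrixForm]
  -- Testing the hypothesis in the trivial representation, with one vector zero, gives positivity of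
  -- the two diagonal blocks.
  let x : (trivialRep G).H := EuclideanSpace.single PUnit.unit 1
  have hx : ‖x‖ = 1 := by
    change ‖(EuclideanSpace.single PUnit.unit 1 : EuclideanSpace ℂ PUnit.{u + 1})‖ = 1
    simp
  have hA : ∀ c : n → ℂ, 0 ≤ (star c ⬝ᵥ (A *ᵥ c)).re := fun c => by
    have h1 := h (trivialRep G) (fun p => c p • x) 0
    rw [matrixForm_smul, hx, hform0, UnitaryRep.coeffForm_zero_right] at h1
    simpa using h1
  have hB : ∀ c : n → ℂ, 0 ≤ (star c ⬝ᵥ (B *ᵥ c)).re := fun c => by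
    have h1 := h (trivialRep G) 0 (fun p => c p • x)
    rw [matrixForm_smul, hx, hform0, UnitaryRep.coeffForm_zero_left] at h1
    simpa using h1
  have key : ∀ δ : ℝ, 0 < δ → 0 ≤ C * (matrixForm A ξ).re + C * (matrixForm B η).re +
      (σ.coeffForm s a FreeGroup.of ξ η).re +
        δ * (C * ((∑ p, ‖ξ p‖ ^ 2) + ∑ q, ‖η q‖ ^ 2)) := by
    intro δ hδ
    obtain ⟨S, hSu, hSA⟩ := exists_factorization A hA hδ
    obtain ⟨T, hTu, hTB⟩ := exists_factorization B hB hδ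
    have hSi : S * S⁻¹ = 1 := Matrix.mul_nonsing_inv _ ((Matrix.isUnit_iff_isUnit_det _).mp hSu)
    have hTi : T * T⁻¹ = 1 := Matrix.mul_nonsing_inv _ ((Matrix.isUnit_iff_isUnit_det _).mp hTu)
    have hSi' : S⁻¹ * S = 1 := Matrix.nonsing_inv_mul _ ((Matrix.isUnit_iff_isUnit_det _).mp hSu)
    have hTi' : T⁻¹ * T = 1 := Matrix.nonsing_inv_mul _ ((Matrix.isUnit_iff_isUnit_det _).mp hTu)
    have hnorm : ∀ {H : Type u} [NormedAddCommGroup H] [InnerProductSpace ℂ H]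
        (D U : Matrix n n ℂ), Uᴴ * U = (2⁻¹ : ℂ) • (D + Dᴴ) + (δ : ℂ) • 1 → ∀ ζ : n → H,
        ∑ p, ‖matrixAct U ζ p‖ ^ 2 = (matrixForm D ζ).re + δ * ∑ p, ‖ζ p‖ ^ 2 := by
      intro H _ _ D U hU ζ
      have h1 := re_matrixForm_add D δ ζ
      rw [← hU, matrixForm_conjTranspose_mul_self] at h1
      exact_mod_cast h1
    -- This is the `2 × 2` block criterion: dividing the corner by `S` and `T` turns positivity into
    -- a norm bound. The bound is `2` because the hypothesis contains the corner form once and not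
    -- twice.
    have hbound : ∀ (π : UnitaryRep G) (ξ η : n → π.H),
        ‖π.coeffForm s (fun i => (S⁻¹)ᴴ * a i * T⁻¹) g ξ η‖ ≤
          2 * (((∑ p, ‖ξ p‖ ^ 2) + ∑ q, ‖η q‖ ^ 2) / 2) := by
      intro π ξ η
      rw [← UnitaryRep.coeffForm_matrixAct]
      have h1 := hnorm A S hSA (matrixAct S⁻¹ ξ)
      have h2 := hnorm B T hTB (matrixAct T⁻¹ η)
      rw [matrixAct_mul, hSi, matrixAct_one] at h1
      rw [matrixAct_mul, hTi, matrixAct_one] at h2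
      set ξ' := matrixAct S⁻¹ ξ
      set η' := matrixAct T⁻¹ η
      -- A phase on `η'` makes the corner form equal to minus its modulus.
      obtain ⟨c, hc, hcz⟩ : ∃ c : ℂ, ‖c‖ = 1 ∧
          c * π.coeffForm s a g ξ' η' = -(‖π.coeffForm s a g ξ' η'‖ : ℂ) := by
        obtain ⟨c, hc, h3⟩ := RCLike.exists_norm_eq_mul_self (K := ℂ) (π.coeffForm s a g ξ' η')
        refine ⟨-c, by rwa [norm_neg], ?_⟩
        rw [neg_mul, ← h3]; rfl
      have h3 := h π ξ' fun q => c • η' q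
      rw [UnitaryRep.coeffForm_smul_right, hcz] at h3
      have h4 : matrixForm B (fun q => c • η' q) = matrixForm B η' := by
        simp only [matrixForm, inner_smul_left, inner_smul_right]
        have : (starRingEnd ℂ) c * c = 1 := by
          rw [← Complex.normSq_eq_conj_mul_self, Complex.normSq_eq_norm_sq, hc]; simp
        refine Finset.sum_congr rfl fun p _ => Finset.sum_congr rfl fun q _ => ?_
        rw [← mul_assoc c, mul_comm c, ← mul_assoc, ← mul_assoc, mul_assoc _ _ c, this, mul_one]
      rw [h4] at h3
      simp only [Complex.neg_re, Complex.ofReal_re] at h3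
      have h5 : 0 ≤ δ * ∑ p, ‖ξ' p‖ ^ 2 := by positivity
      have h6 : 0 ≤ δ * ∑ p, ‖η' p‖ ^ 2 := by positivity
      linarith
    have h1 := norm_coeffForm_le_of_sidon hC hS s _ (by norm_num : (0 : ℝ) ≤ 2) hbound σ
      (matrixAct S ξ) (matrixAct T η)
    rw [← UnitaryRep.coeffForm_matrixAct, matrixAct_mul, matrixAct_mul, hSi', hTi', matrixAct_one,
      matrixAct_one, hnorm A S hSA, hnorm B T hTB] at h1
    have h2 := (abs_le.mp ((Complex.abs_re_le_norm _).trans h1)).1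
    linarith
  by_contra! hneg
  set X := C * (matrixForm A ξ).re + C * (matrixForm B η).re +
      (σ.coeffForm s a FreeGroup.of ξ η).re
  have hY : 0 ≤ C * ((∑ p, ‖ξ p‖ ^ 2) + ∑ q, ‖η q‖ ^ 2) := by positivity
  set Y := C * ((∑ p, ‖ξ p‖ ^ 2) + ∑ q, ‖η q‖ ^ 2)
  -- With this `δ` the error `δ * Y` is at most half of `-X`.
  have h1 := key (-X / (2 * (Y + 1))) (by apply div_pos <;> linarith)
  have h2 : -X / (2 * (Y + 1)) * Y ≤ -X / 2 := by
    rw [div_mul_eq_mul_div, div_le_div_iff₀ (by positivity) (by norm_num)]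
    nlinarith
  linarith

end OperatorSystem

/-! ### Hahn–Banach extension to positive definite functions. -/

section Extension

variable {Γ : Type u} {J : Type}

/-- The linear functional on `M_J(ℂ[Γ])` given by a matrix of functions on `Γ`. -/
noncomputable def coeffFunctional (κ : J → J → Γ → ℂ) : (J × J × Γ →₀ ℂ) →ₗ[ℂ] ℂ :=
  Finsupp.linearCombination ℂ fun y => κ y.1 y.2.1 y.2.2

theorem coeffFunctional_single (κ : J → J → Γ → ℂ) (y : J × J × Γ) (z : ℂ) :
    coeffFunctional κ (Finsupp.single y z) = z * κ y.1 y.2.1 y.2.2 := by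
  simp [coeffFunctional]

variable [Group Γ]

/-- The cone of elements of `M_J(ℂ[Γ])` on which the real parts of all positive definite functions
are nonnegative. -/
noncomputable def dualCone (J : Type) (Γ : Type u) [Group Γ] :
    PointedCone ℝ (J × J × Γ →₀ ℂ) where
  carrier := {x | ∀ κ : J → J → Γ → ℂ, IsPosDefFun κ → 0 ≤ (coeffFunctional κ x).re}
  add_mem' hx hy κ hκ := by
    rw [map_add, Complex.add_re]
    exact add_nonneg (hx κ hκ) (hy κ hκ)
  zero_mem' κ _ := by simp
  smul_mem' r x hx κ hκ := by
    have : (r • x : J × J × Γ →₀ ℂ) = ((r : ℝ) : ℂ) • x := by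
      ext y
      simp
    rw [this, map_smul, smul_eq_mul, Complex.re_ofReal_mul]
    exact mul_nonneg r.2 (hx κ hκ)

theorem mem_dualCone {x : J × J × Γ →₀ ℂ} :
    x ∈ dualCone J Γ ↔ ∀ κ : J → J → Γ → ℂ, IsPosDefFun κ → 0 ≤ (coeffFunctional κ x).re :=
  Iff.rfl

theorem IsPosDefFun.norm_apply_le {κ : J → J → Γ → ℂ} (h : IsPosDefFun κ) (i j : J) (γ : Γ) :
    ‖κ i j γ‖ ≤ (κ i i 1).re + (κ j j 1).re := by
  obtain ⟨H, _, _, _, v, ρ, hv⟩ := h.exists_rep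
  have h1 : ∀ i, (κ i i 1).re = ‖v i‖ ^ 2 := fun i => by
    have h2 := hv i i 1
    simp only [map_one, OneMemClass.coe_one, one_apply_eq_self, inner_self_eq_norm_sq_to_K] at h2
    have h3 : κ i i 1 = ((‖v i‖ ^ 2 : ℝ) : ℂ) := by push_cast; exact h2.symm
    rw [h3, Complex.ofReal_re]
  rw [← hv, h1, h1]
  refine (norm_inner_le_norm _ _).trans ?_
  have h5 : ∀ γ, ‖(ρ γ : H →L[ℂ] H)‖ ≤ 1 := fun γ => by
    rcases subsingleton_or_nontrivial H with hH | hH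
    · rw [Subsingleton.elim (ρ γ : H →L[ℂ] H) 0, norm_zero]; exact zero_le_one
    · exact (CStarRing.norm_coe_unitary (ρ γ)).le
  have h4 : ‖(ρ γ : H →L[ℂ] H) (v j)‖ ≤ ‖v j‖ := by
    refine ((ρ γ : H →L[ℂ] H).le_opNorm _).trans ?_
    have : ‖(ρ γ : H →L[ℂ] H)‖ ≤ 1 := h5 γ
    nlinarith [norm_nonneg (v j)]
  nlinarith [norm_nonneg (v i), norm_nonneg (v j), sq_nonneg (‖v i‖ - ‖v j‖)]

/-- This makes the sum of the diagonal units an order unit for `dualCone`, as `riesz_extension`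
requires. -/
theorem norm_coeffFunctional_le [Fintype J] {κ : J → J → Γ → ℂ} (h : IsPosDefFun κ)
    (x : J × J × Γ →₀ ℂ) :
    ‖coeffFunctional κ x‖ ≤ (∑ y ∈ x.support, ‖x y‖) * (2 * ∑ i, (κ i i 1).re) := by
  rw [coeffFunctional, Finsupp.linearCombination_apply, Finsupp.sum, Finset.sum_mul]
  refine norm_sum_le_of_le _ fun y _ => ?_
  rw [norm_smul]
  refine mul_le_mul_of_nonneg_left ((h.norm_apply_le _ _ _).trans ?_) (norm_nonneg _)
  have h1 : ∀ i, (κ i i 1).re ≤ ∑ i, (κ i i 1).re := fun i =>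
    Finset.single_le_sum (f := fun i => (κ i i 1).re) (fun i _ => by
      have := h.norm_apply_le i i 1
      linarith [norm_nonneg (κ i i 1)]) (Finset.mem_univ i)
  linarith [h1 y.1, h1 y.2.1]

/-- Extension of a positive functional on an operator system to a positive definite function. -/
theorem exists_isPosDefFun_extension [Fintype J] {Z : Set (J × J × Γ)}
    (hZ : ∀ i, (i, i, 1) ∈ Z) (φ : J → J → Γ → ℂ)
    (h : ∀ x ∈ dualCone J Γ, ↑x.support ⊆ Z → 0 ≤ (coeffFunctional φ x).re) :
    ∃ s : J → J → Γ → ℂ, IsPosDefFun s ∧ ∀ i j γ, (i, j, γ) ∈ Z → s i j γ = φ i j γ := by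
  classical
  let f : (J × J × Γ →₀ ℂ) →ₗ.[ℝ] ℝ :=
    { domain := (Finsupp.supported ℂ ℂ Z).restrictScalars ℝ
      toFun := Complex.reLm ∘ₗ (coeffFunctional φ).restrictScalars ℝ ∘ₗ Submodule.subtype _ }
  have hf : ∀ x : f.domain, f x = (coeffFunctional φ x).re := fun _ => rfl
  obtain ⟨Φ, hΦ, hpos⟩ := riesz_extension (dualCone J Γ) f
    (fun x hx => h x hx ((Finsupp.mem_supported ℂ _).mp x.2)) fun x => by
      let u : J × J × Γ →₀ ℂ := ((2 * ∑ y ∈ x.support, ‖x y‖ : ℝ) : ℂ) •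
        ∑ i, Finsupp.single (i, i, 1) 1
      have hu : u ∈ Finsupp.supported ℂ ℂ Z := Submodule.smul_mem _ _
        (Submodule.sum_mem _ fun i _ => Finsupp.single_mem_supported ℂ _ (hZ i))
      refine ⟨⟨u, hu⟩, mem_dualCone.mpr fun κ hκ => ?_⟩
      have h1 : (coeffFunctional κ u).re =
          (2 * ∑ y ∈ x.support, ‖x y‖) * ∑ i, (κ i i 1).re := by
        rw [map_smul, map_sum, smul_eq_mul, Complex.re_ofReal_mul, Complex.re_sum]
        simp [coeffFunctional_single]
      rw [map_add, Complex.add_re, h1]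
      have h2 := (abs_le.mp ((Complex.abs_re_le_norm _).trans (norm_coeffFunctional_le hκ x))).1
      linarith
  -- The complex functional with real part `Φ` is `Φ x - I * Φ (I • x)`.
  let s : J → J → Γ → ℂ := fun i j γ =>
    Φ (Finsupp.single (i, j, γ) 1) - Complex.I * Φ (Finsupp.single (i, j, γ) Complex.I)
  have hs : ∀ x, (coeffFunctional s x).re = Φ x := by
    intro x
    induction x using Finsupp.induction_linear with
    | zero => simp
    | add x y hx hy => rw [map_add, map_add, Complex.add_re, hx, hy]
    | single y z =>
      have h1 : Finsupp.single y z =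
          z.re • Finsupp.single y (1 : ℂ) + z.im • Finsupp.single y Complex.I := by
        rw [Finsupp.smul_single, Finsupp.smul_single, ← Finsupp.single_add]
        congr 1
        apply Complex.ext <;> simp
      have h2 : Φ (Finsupp.single y z) = z.re * Φ (Finsupp.single y 1) +
          z.im * Φ (Finsupp.single y Complex.I) := by
        rw [h1, map_add, map_smul, map_smul, smul_eq_mul, smul_eq_mul]
      rw [h2, coeffFunctional_single]
      simp [s]
  have hcone : ∀ x, x ∈ dualCone J Γ → 0 ≤ (coeffFunctional s x).re := fun x hx => by
    rw [hs]; exact hpos x hx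
  -- If all values at `x` are real, `I • x` and `-I • x` both lie in the cone, so the imaginary part
  -- vanishes.
  have hreal : ∀ x, (∀ κ : J → J → Γ → ℂ, IsPosDefFun κ → 0 ≤ coeffFunctional κ x) →
      0 ≤ coeffFunctional s x := fun x hx => by
    have h1 := hcone x (mem_dualCone.mpr fun κ hκ => (Complex.nonneg_iff.mp (hx κ hκ)).1)
    have h2 := hcone (Complex.I • x) (mem_dualCone.mpr fun κ hκ => by
      simp [← (Complex.nonneg_iff.mp (hx κ hκ)).2])
    have h3 := hcone (-Complex.I • x) (mem_dualCone.mpr fun κ hκ => by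
      simp [← (Complex.nonneg_iff.mp (hx κ hκ)).2])
    simp only [map_smul, smul_eq_mul, Complex.mul_re, Complex.I_re, Complex.I_im, Complex.neg_re,
      Complex.neg_im] at h2 h3
    exact Complex.nonneg_iff.mpr ⟨h1, by linarith⟩
  refine ⟨s, ⟨?_, fun c => ?_⟩, fun i j γ hy => ?_⟩
  · have h1 : ∀ i j γ (z : ℂ), (z * s i j γ).re = (star z * s j i γ⁻¹).re := fun i j γ z => by
      have h2 : ∀ κ : J → J → Γ → ℂ, IsPosDefFun κ →
          (z * κ i j γ).re = (star z * κ j i γ⁻¹).re := fun κ hκ => by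
        rw [← hκ.star_apply, ← star_mul', RCLike.star_def, Complex.conj_re]
      have h3 := hcone (Finsupp.single (i, j, γ) z - Finsupp.single (j, i, γ⁻¹) (star z))
        (mem_dualCone.mpr fun κ hκ => by
          rw [map_sub, coeffFunctional_single, coeffFunctional_single, Complex.sub_re, h2 κ hκ,
            sub_self])
      have h4 := hcone (Finsupp.single (j, i, γ⁻¹) (star z) - Finsupp.single (i, j, γ) z)
        (mem_dualCone.mpr fun κ hκ => by
          rw [map_sub, coeffFunctional_single, coeffFunctional_single, Complex.sub_re, h2 κ hκ,
            sub_self])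
      rw [map_sub, coeffFunctional_single, coeffFunctional_single, Complex.sub_re] at h3 h4
      linarith
    ext x y
    rw [Matrix.conjTranspose_apply, Matrix.of_apply, Matrix.of_apply, RCLike.star_def]
    have h2 := h1 x.2 y.2 (x.1⁻¹ * y.1) 1
    have h3 := h1 x.2 y.2 (x.1⁻¹ * y.1) Complex.I
    rw [mul_inv_rev, inv_inv] at h2 h3
    simp at h2 h3
    apply Complex.ext
    · simp [h2]
    · simp [← h3]
  · have h1 : ∀ κ : J → J → Γ → ℂ, coeffFunctional κ (c.sum fun x cx => c.sum fun y cy =>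
        Finsupp.single (x.2, y.2, x.1⁻¹ * y.1) (star cx * cy)) =
        c.sum fun x cx => c.sum fun y cy => star cx * κ x.2 y.2 (x.1⁻¹ * y.1) * cy := fun κ => by
      simp only [Finsupp.sum, map_sum, coeffFunctional_single]
      refine Finset.sum_congr rfl fun x _ => Finset.sum_congr rfl fun y _ => ?_
      ring
    have h2 := hreal _ fun κ hκ => (h1 κ).symm ▸ hκ.2 c
    rwa [h1] at h2
  · have h1 : ∀ z : ℂ, Φ (Finsupp.single (i, j, γ) z) = (z * φ i j γ).re := fun z => by
      rw [hΦ ⟨_, Finsupp.single_mem_supported ℂ z hy⟩, hf, coeffFunctional_single]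
    simp only [s, h1]
    apply Complex.ext <;> simp

end Extension

/-! ### The positive definite function of a Sidon set, via finite quotients. -/

section FiniteQuotient

variable {K : Type u} [Group K]

/-- The vector states of the product of a unitary representation and the regular representation of
a finite quotient. -/
theorem IsPosDefFun.sum_inner_regular {G F : Type u} [Group G] [Group F] {J : Type}
    [Fintype K] (σ : F →* K) (π : UnitaryRep G) (ζ : J → K → π.H) :
    IsPosDefFun fun i j (γ : G × F) =>
      ∑ q, inner ℂ (ζ i (σ γ.2 * q)) ((π.hom γ.1 : π.H →L[ℂ] π.H) (ζ j q)) := by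
  refine IsPosDefFun.of_inner (H := PiLp 2 fun _ : K => π.H) (fun x j => WithLp.toLp 2 fun p =>
    (π.hom x.1 : π.H →L[ℂ] π.H) (ζ j ((σ x.2)⁻¹ * p))) fun i j x y => ?_
  rw [PiLp.inner_apply]
  refine Fintype.sum_equiv (Equiv.mulLeft (σ y.2)) _ _ fun q => ?_
  simp [UnitaryRep.inner_hom_hom, mul_assoc]

theorem sum_translation_mul [Fintype K] [DecidableEq K] {Y : Type*} (S : Finset Y) (x : Y → ℂ)
    (P : Y → Prop) [DecidablePred P] (k : Y → K) (Ξ : K → K → ℂ) :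
    ∑ p, ∑ q, (∑ y ∈ S, x y * if P y ∧ p = k y * q then 1 else 0) * Ξ p q =
      ∑ y ∈ S, x y * if P y then ∑ q, Ξ (k y * q) q else 0 := by
  simp only [Finset.sum_mul]
  rw [Finset.sum_congr rfl fun p _ => Finset.sum_comm, Finset.sum_comm]
  refine Finset.sum_congr rfl fun y _ => ?_
  rw [Finset.sum_comm]
  by_cases hP : P y
  · simp only [hP, true_and, if_true, Finset.mul_sum]
    refine Finset.sum_congr rfl fun q _ => ?_
    rw [Finset.sum_eq_single (k y * q)]
    · simp
    · intro p _ hp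
      simp [hp]
    · simp
  · simp [hP]

/-- The unitary representation coming from the regular representation of a finite quotient. -/
theorem exists_regular_rep [DecidableEq K] {F : Type u} [Group F] (σ : F →* K) :
    ∃ (ρ : UnitaryRep F) (e : K → ρ.H), ∀ p q w,
      inner ℂ (e p) ((ρ.hom w : ρ.H →L[ℂ] ρ.H) (e q)) = if p = σ w * q then 1 else 0 := by
  let _ : MulAction F K := MulAction.compHom K σ
  have hs : ∀ (w : F) (q : K), w • q = σ w * q := fun _ _ => rfl
  have h1 : (1 : Matrix K K ℂ).PosSemidef := Matrix.PosSemidef.one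
  obtain ⟨H, i1, i2, i3, e, ρ, he, -, hρ⟩ := h1.exists_unitary (Γ := F) fun w p q => by
    simp [hs, Matrix.one_apply]
  have : Nontrivial H := ⟨e 1, 0, fun h0 => by simpa [h0] using he 1 1⟩
  refine ⟨UnitaryRep.mk H ρ, e, fun p q w => ?_⟩
  have h2 : (ρ w : H →L[ℂ] H) (e q) = e (σ w * q) := hρ w q
  change inner ℂ (e p) ((ρ w : H →L[ℂ] H) (e q)) = _
  rw [h2, he, Matrix.one_apply]

end FiniteQuotient

section SidonExtension

variable {G ι : Type u} [Group G]

open Classical in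
/-- The values prescribed by a Sidon family on the diagonal and in the upper right corner. -/
noncomputable def sidonValues (C : ℝ) (i j : Fin 2) (γ : G × FreeGroup ι) (g : ι → G) : ℂ :=
  if i = j then (if γ.2 = 1 then C else 0) else if ∃ t, γ = (g t, FreeGroup.of t) then 1 else 0

/-- The prescribed values come from sending `g t` to the free generator and pairing with the
canonical trace of the free group. A finitely supported test element sees only finitely many words,
so the free group may be replaced by a finite quotient, whose regular representation turns the
second coordinate into matrix coefficients for the Sidon inequality. -/
theorem exists_isPosDefFun_of_sidon {g : ι → G} (hg : Function.Injective g) {C : ℝ} (hC : 0 ≤ C)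
    (hS : ∀ (m : ℕ) (s : Finset ι) (a : ι → Matrix (Fin m) (Fin m) ℂ),
      ‖matrixCoeffSum s a
        (fun i => (GroupCStar.universalRep (FreeGroup.of i) : GroupCStar (FreeGroup ι)))‖ ≤
      C * ‖matrixCoeffSum s a (fun i => (GroupCStar.universalRep (g i) : GroupCStar G))‖) :
    ∃ s : Fin 2 → Fin 2 → G × FreeGroup ι → ℂ, IsPosDefFun s ∧
      (∀ i, s i i 1 = C) ∧ (∀ i w, w ≠ 1 → s i i (1, w) = 0) ∧
      (∀ t, s 0 1 (g t, FreeGroup.of t) = 1) ∧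
      ∀ t w, w ≠ FreeGroup.of t → s 0 1 (g t, w) = 0 := by
  classical
  let Z : Set (Fin 2 × Fin 2 × G × FreeGroup ι) :=
    {y | (y.1 = y.2.1 ∧ y.2.2.1 = 1) ∨ (y.1 = 0 ∧ y.2.1 = 1 ∧ ∃ t, g t = y.2.2.1)}
  obtain ⟨s, hs, hsZ⟩ := exists_isPosDefFun_extension (Z := Z) (fun i => Or.inl ⟨rfl, rfl⟩)
    (fun i j γ => sidonValues C i j γ g) (fun x hx hxZ => by
      let T : Finset ι := (x.support.image fun y => y.2.2.1).preimage g hg.injOn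
      let W : Finset (FreeGroup ι) := x.support.image fun y => y.2.2.2
      -- The quotient must separate the words that occur both from `1` and from the relevant
      -- generators.
      let S : Finset (FreeGroup ι) :=
        (W ∪ (W ×ˢ T).image fun z => (FreeGroup.of z.2)⁻¹ * z.1).erase 1
      obtain ⟨V, _, _, σ, hσ⟩ := FreeGroup.exists_perm_ne_one S (Finset.notMem_erase _ _)
      have hT : ∀ y ∈ x.support, ∀ t, g t = y.2.2.1 → t ∈ T := fun y hy t ht =>
        Finset.mem_preimage.mpr (ht ▸ Finset.mem_image_of_mem _ hy)
      have hW : ∀ y ∈ x.support, y.2.2.2 ∈ W := fun y hy => Finset.mem_image_of_mem _ hy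
      have hσ1 : ∀ w ∈ W, (σ w = 1 ↔ w = 1) := fun w hw => by
        refine ⟨fun h => by_contra fun hne => hσ w ?_ h, fun h => by rw [h, map_one]⟩
        exact Finset.mem_erase.mpr ⟨hne, Finset.mem_union_left _ hw⟩
      have hσ2 : ∀ w ∈ W, ∀ t ∈ T, (σ w = σ (FreeGroup.of t) ↔ w = FreeGroup.of t) :=
        fun w hw t ht => by
          refine ⟨fun h => by_contra fun hne => hσ ((FreeGroup.of t)⁻¹ * w) ?_ ?_,
            fun h => by rw [h]⟩
          · refine Finset.mem_erase.mpr ⟨fun h1 => hne (inv_mul_eq_one.mp h1).symm,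
              Finset.mem_union_right _ ?_⟩
            exact Finset.mem_image.mpr ⟨(w, t), Finset.mem_product.mpr ⟨hw, ht⟩, rfl⟩
          · rw [map_mul, map_inv, h, inv_mul_cancel]
      let A : Fin 2 → Matrix (Equiv.Perm V) (Equiv.Perm V) ℂ := fun i => Matrix.of fun p q =>
        ∑ y ∈ x.support, x y * if (y.1 = i ∧ y.2.1 = i) ∧ p = σ y.2.2.2 * q then 1 else 0
      let a : ι → Matrix (Equiv.Perm V) (Equiv.Perm V) ℂ := fun t => Matrix.of fun p q =>
        ∑ y ∈ x.support, x y * if (y.1 = 0 ∧ y.2.1 = 1 ∧ y.2.2.1 = g t) ∧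
          p = σ y.2.2.2 * q then 1 else 0
      have hA : ∀ {H : Type u} [NormedAddCommGroup H] [InnerProductSpace ℂ H]
          (i : Fin 2) (ζ : Equiv.Perm V → H), matrixForm (A i) ζ =
          ∑ y ∈ x.support, x y * if y.1 = i ∧ y.2.1 = i then
            ∑ q, inner ℂ (ζ (σ y.2.2.2 * q)) (ζ q) else 0 := fun i ζ =>
        sum_translation_mul x.support x _ _ _
      have ha : ∀ {G' : Type u} [Group G'] (π : UnitaryRep G') (g' : ι → G')
          (ξ η : Equiv.Perm V → π.H), π.coeffForm T a g' ξ η =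
          ∑ y ∈ x.support, x y * ∑ t ∈ T, if y.1 = 0 ∧ y.2.1 = 1 ∧ y.2.2.1 = g t then
            ∑ q, inner ℂ (ξ (σ y.2.2.2 * q)) ((π.hom (g' t) : π.H →L[ℂ] π.H) (η q)) else 0 := by
        intro G' _ π g' ξ η
        unfold UnitaryRep.coeffForm
        rw [Finset.sum_congr rfl fun p _ => Finset.sum_comm, Finset.sum_comm]
        simp only [Finset.mul_sum (s := T)]
        rw [Finset.sum_comm (t := T)]
        exact Finset.sum_congr rfl fun t _ => sum_translation_mul x.support x _ _ _
      have key := re_coeffForm_nonneg_of_sidon hC hS T a (A 0) (A 1) (fun π ξ η => by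
        let ζ : Fin 2 → Equiv.Perm V → π.H := ![ξ, η]
        have h1 := hx _ (IsPosDefFun.sum_inner_regular σ π ζ)
        have h2 : matrixForm (A 0) ξ + matrixForm (A 1) η + π.coeffForm T a g ξ η =
            coeffFunctional (fun i j (γ : G × FreeGroup ι) => ∑ q, inner ℂ (ζ i (σ γ.2 * q))
              ((π.hom γ.1 : π.H →L[ℂ] π.H) (ζ j q))) x := by
          rw [hA, hA, ha, coeffFunctional, Finsupp.linearCombination_apply, Finsupp.sum,
            ← Finset.sum_add_distrib, ← Finset.sum_add_distrib]
          refine Finset.sum_congr rfl fun y hy => ?_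
          rw [← mul_add, ← mul_add, smul_eq_mul]
          congr 1
          obtain ⟨i, j, γ, w⟩ := y
          rcases hxZ hy with ⟨hij, hγ⟩ | ⟨hi, hj, t, ht⟩
          · dsimp only at hij hγ
            subst hij hγ
            fin_cases i <;> simp [ζ]
          · dsimp only at hi hj ht
            subst hi hj ht
            rw [Finset.sum_eq_single_of_mem t (hT _ hy t rfl)]
            · simp [ζ]
            · intro t' _ hne
              simp [hg.eq_iff, hne.symm]
        rw [← h2] at h1
        simpa using h1)
      obtain ⟨ρ, e, he⟩ := exists_regular_rep σ
      -- At the standard basis, each translation contributes its unnormalised trace: the order of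
      -- the quotient or zero.
      have h1 := key ρ e e
      have h2 : C * matrixForm (A 0) e + C * matrixForm (A 1) e +
          ρ.coeffForm T a FreeGroup.of e e =
          Fintype.card (Equiv.Perm V) * coeffFunctional (fun i j γ => sidonValues C i j γ g) x := by
        rw [hA, hA, ha, coeffFunctional, Finsupp.linearCombination_apply, Finsupp.sum,
          Finset.mul_sum, Finset.mul_sum, Finset.mul_sum,
          ← Finset.sum_add_distrib, ← Finset.sum_add_distrib]
        refine Finset.sum_congr rfl fun y hy => ?_
        have hone : ∀ p q : Equiv.Perm V, inner ℂ (e p) (e q) = if p = q then 1 else 0 :=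
          fun p q => by simpa using he p q 1
        simp only [hone, he, mul_eq_right, mul_left_inj, hσ1 _ (hW y hy), Finset.sum_const,
          Finset.card_univ, smul_eq_mul, nsmul_eq_mul]
        have h4 : ∀ t ∈ T, (σ y.2.2.2 = σ (FreeGroup.of t)) = (y.2.2.2 = FreeGroup.of t) :=
          fun t ht => propext (hσ2 _ (hW y hy) t ht)
        obtain ⟨i, j, γ, w⟩ := y
        rcases hxZ hy with ⟨hij, hγ⟩ | ⟨hi, hj, t, ht⟩
        · dsimp only at hij hγ
          subst hij hγ
          fin_cases i <;> simp [sidonValues] <;> ring_nf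
        · dsimp only at hi hj ht
          subst hi hj ht
          rw [Finset.sum_eq_single_of_mem t (hT _ hy t rfl)]
          · have h5 : (∃ t', (g t, w) = (g t', FreeGroup.of t')) ↔ w = FreeGroup.of t := by
              refine ⟨?_, fun h => ⟨t, by rw [h]⟩⟩
              rintro ⟨t', h⟩
              rw [Prod.mk.injEq] at h
              rw [h.2, hg h.1]
            simp only [h4 t (hT _ hy t rfl), sidonValues, h5]
            simp
            ring_nf
          · intro t' _ hne
            simp [hg.eq_iff, hne.symm]
      have h3 := congrArg Complex.re h2
      rw [← Complex.ofReal_natCast, Complex.re_ofReal_mul, Complex.add_re, Complex.add_re,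
        Complex.re_ofReal_mul, Complex.re_ofReal_mul] at h3
      rw [h3] at h1
      exact nonneg_of_mul_nonneg_right h1 (by exact_mod_cast Fintype.card_pos))
  refine ⟨s, hs, fun i => ?_, fun i w hw => ?_, fun t => ?_, fun t w hw => ?_⟩
  · rw [hsZ _ _ _ (Or.inl ⟨rfl, rfl⟩)]
    simp [sidonValues]
  · rw [hsZ _ _ _ (Or.inl ⟨rfl, rfl⟩)]
    simp [sidonValues, hw]
  · rw [hsZ _ _ _ (Or.inr ⟨rfl, rfl, t, rfl⟩)]
    simp only [sidonValues, if_pos (⟨t, rfl⟩ : ∃ t', (g t, FreeGroup.of t) = (g t', FreeGroup.of t'))]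
    simp
  · rw [hsZ _ _ _ (Or.inr ⟨rfl, rfl, t, rfl⟩)]
    have : ¬ ∃ t', (g t, w) = (g t', FreeGroup.of t') := by
      rintro ⟨t', h⟩
      rw [Prod.mk.injEq] at h
      exact hw (hg h.1 ▸ h.2)
    simp only [sidonValues, if_neg this]
    simp

end SidonExtension

-- The indicator of a subgroup is positive definite, being the Kronecker delta on cosets; `x.1 * (φ
-- x.2)⁻¹` labels the coset of `x` for the graph of `φ`.
open Classical in
theorem IsPosDefFun.graph {G F J : Type*} [Group G] [Group F] (φ : F →* G) :
    IsPosDefFun fun (_ _ : J) (γ : G × F) => if φ γ.2 = γ.1 then (1 : ℂ) else 0 := by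
  have h1 : (1 : Matrix G G ℂ).PosSemidef := Matrix.PosSemidef.one
  refine posSemidef_congr (h1.submatrix fun x : (G × F) × J => x.1.1 * (φ x.1.2)⁻¹) fun x y => ?_
  rw [Matrix.of_apply, Matrix.submatrix_apply, Matrix.one_apply]
  refine if_congr ?_ rfl rfl
  simp only [Prod.snd_mul, Prod.fst_mul, Prod.snd_inv, Prod.fst_inv, map_mul, map_inv]
  rw [eq_mul_inv_iff_mul_eq, mul_assoc]
  exact eq_inv_mul_iff_mul_eq

/-! ### The approximating multiplier and the union theorem. -/

section Interpolation

variable {G ι : Type u} [Group G]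

/-- The indicator function of a completely Sidon set is approximated uniformly by completely
bounded multipliers of `C*(G)`. -/
theorem exists_multiplier_of_sidon {g : ι → G} (hg : Function.Injective g) {C : ℝ} (hC : 0 < C)
    (hS : ∀ (m : ℕ) (s : Finset ι) (a : ι → Matrix (Fin m) (Fin m) ℂ),
      ‖matrixCoeffSum s a
        (fun i => (GroupCStar.universalRep (FreeGroup.of i) : GroupCStar (FreeGroup ι)))‖ ≤
      C * ‖matrixCoeffSum s a (fun i => (GroupCStar.universalRep (g i) : GroupCStar G))‖)
    {ε : ℝ} (hε : 0 < ε) :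
    ∃ (f : G → ℂ) (D : ℝ), 0 ≤ D ∧ (∀ t, f (g t) = 1) ∧ (∀ γ, γ ∉ Set.range g → ‖f γ‖ ≤ ε) ∧
      ∀ {κ : Type u} (m : ℕ) (s : Finset κ) (a : κ → Matrix (Fin m) (Fin m) ℂ) (k : κ → G),
        ‖matrixCoeffSum s (fun i => f (k i) • a i)
          (fun i => (GroupCStar.universalRep (k i) : GroupCStar G))‖ ≤
        D * ‖matrixCoeffSum s a (fun i => (GroupCStar.universalRep (k i) : GroupCStar G))‖ := by
  classical
  obtain ⟨s, hs, hs1, hs0, hst, hst0⟩ := exists_isPosDefFun_of_sidon hg hC.le hS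
  -- After division by `r` the values off the set are at most `r * C ^ 2`, which must not exceed
  -- `ε`.
  let r : ℝ := min 1 (ε / C ^ 2)
  have hr0 : 0 < r := lt_min one_pos (by positivity)
  have hr : r * C ^ 2 ≤ ε := by
    rw [← le_div_iff₀ (by positivity)]
    exact min_le_right _ _
  obtain ⟨θ, hθ, hθ1, hθt, hθ0⟩ :=
    FreeGroup.exists_posDefFun_generators (α := ι) hr0.le (min_le_left 1 (ε / C ^ 2) : r ≤ 1)
  let φ : FreeGroup ι →* G := FreeGroup.lift g
  -- The graph factor forces `φ w = γ`, so for `γ` outside the set no generator contributes.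
  have hs' := (hs.mul (IsPosDefFun.graph φ)).mul (hθ.comp_hom (MonoidHom.snd G (FreeGroup ι)))
  have hh := IsPosDefFun.tsum_mul_star hs' hs (fun i w hw => by simp [hs0 i w hw]) hs0
  set h : Fin 2 → Fin 2 → G → ℂ := fun i j γ => ∑' w, s i j (γ, w) *
    (if φ w = γ then 1 else 0) * θ i j w * star (s i j (γ, w)) with hdef
  have h1 : ∀ i, h i i 1 = ((C ^ 2 : ℝ) : ℂ) := fun i => by
    have h2 : s i i (1, 1) = C := hs1 i
    simp only [hdef]
    rw [tsum_eq_single 1 fun w hw => by simp [hs0 i w hw]]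
    simp [h2, hθ1, sq]
  have ht : ∀ t, h 0 1 (g t) = r := fun t => by
    simp only [hdef]
    rw [tsum_eq_single (FreeGroup.of t) fun w hw => by simp [hst0 t w hw]]
    simp [hst, hθt, φ]
  have hoff : ∀ γ, γ ∉ Set.range g → ‖h 0 1 γ‖ ≤ r ^ 2 * C ^ 2 := fun γ hγ => by
    have h2 : Summable fun w => ‖s 0 1 (γ, w)‖ ^ 2 :=
      summable_of_sum_le (fun _ => sq_nonneg _) (hs.sum_norm_sq_le hC hs0 hs1 0 1 γ)
    refine (tsum_of_norm_bounded (h2.mul_left (r ^ 2)).hasSum fun w => ?_).trans ?_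
    · rw [norm_mul, norm_mul, norm_mul, norm_star]
      split_ifs with hw
      · have h3 := hθ0 w (by rintro ⟨t, rfl⟩; exact hγ ⟨t, by simpa [φ] using hw⟩)
        rw [norm_one, mul_one]
        nlinarith [sq_nonneg ‖s 0 1 (γ, w)‖]
      · simp only [norm_zero, mul_zero, zero_mul]
        positivity
    · rw [tsum_mul_left]
      exact mul_le_mul_of_nonneg_left (h2.tsum_le_of_sum_le
        (hs.sum_norm_sq_le hC hs0 hs1 0 1 γ)) (sq_nonneg _)
  refine ⟨fun γ => (r : ℂ)⁻¹ * h 0 1 γ, r⁻¹ * C ^ 2, by positivity, fun t => ?_, fun γ hγ => ?_,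
    fun m s a k => ?_⟩
  · simp only [ht]
    exact inv_mul_cancel₀ (by exact_mod_cast hr0.ne')
  · rw [norm_mul, norm_inv, Complex.norm_real, Real.norm_of_nonneg hr0.le,
      inv_mul_le_iff₀ hr0]
    have := hoff γ hγ
    nlinarith
  · simp only [mul_smul]
    rw [matrixCoeffSum_smul, norm_smul, norm_inv, Complex.norm_real, Real.norm_of_nonneg hr0.le,
      mul_assoc]
    exact mul_le_mul_of_nonneg_left (norm_matrixCoeffSum_mul_le hh (h1 0).le (h1 1).le s a k)
      (by positivity)

end Interpolation

theorem matrixCoeffSum_preimage {ι κ A : Type*} [AddCommGroup A] [Module ℂ A] {m : ℕ}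
    {e : κ → ι} (he : Function.Injective e) (s : Finset ι) (a : ι → Matrix (Fin m) (Fin m) ℂ)
    (x : ι → A) (ha : ∀ i, i ∉ Set.range e → a i = 0) :
    matrixCoeffSum (s.preimage e he.injOn) (a ∘ e) (x ∘ e) = matrixCoeffSum s a x := by
  ext p q
  exact Finset.sum_preimage e s he.injOn (fun i => a i p q • x i) fun i _ hi => by simp [ha i hi]

/-- The Sidon inequality for a subfamily of free generators indexed by a larger set. -/
theorem norm_matrixCoeffSum_le_of_subfamily {G ι κ : Type u} [Group G] {e : κ → ι}
    (he : Function.Injective e) {g : ι → G} {C : ℝ}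
    (hS : ∀ (m : ℕ) (s : Finset κ) (a : κ → Matrix (Fin m) (Fin m) ℂ),
      ‖matrixCoeffSum s a
        (fun i => (GroupCStar.universalRep (FreeGroup.of i) : GroupCStar (FreeGroup κ)))‖ ≤
      C * ‖matrixCoeffSum s a (fun i => (GroupCStar.universalRep (g (e i)) : GroupCStar G))‖)
    {m : ℕ} (s : Finset ι) (a : ι → Matrix (Fin m) (Fin m) ℂ)
    (ha : ∀ i, i ∉ Set.range e → a i = 0) :
    ‖matrixCoeffSum s a
      (fun i => (GroupCStar.universalRep (FreeGroup.of i) : GroupCStar (FreeGroup ι)))‖ ≤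
    C * ‖matrixCoeffSum s a (fun i => (GroupCStar.universalRep (g i) : GroupCStar G))‖ := by
  rw [← matrixCoeffSum_preimage he s a _ ha, ← matrixCoeffSum_preimage he s a _ ha]
  refine le_trans ?_ (hS m _ _)
  have := norm_matrixCoeffSum_unimodular_le (s.preimage e he.injOn) (a ∘ e)
    (fun i => FreeGroup.of (e i)) (z := 1) (by simp)
  simpa [Function.comp_def] using this

theorem mainTheorem2 {G : Type u} [Group G] (Λ₁ Λ₂ : Set G)
    (h₁ : IsCompletelySidonSet Λ₁) (h₂ : IsCompletelySidonSet Λ₂) :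
    IsCompletelySidonSet (Λ₁ ∪ Λ₂) := by
  classical
  obtain ⟨-, C₁, hC₁⟩ := h₁
  obtain ⟨-, C₂, hC₂⟩ := h₂
  let C : ℝ := max 1 (max C₁ C₂)
  have hC0 : 0 < C := lt_of_lt_of_le one_pos (le_max_left _ _)
  have hS₁ := fun m s a => (hC₁ m s a).trans (mul_le_mul_of_nonneg_right
    (show C₁ ≤ C from (le_max_left _ _).trans (le_max_right _ _)) (norm_nonneg _))
  have hS₂ := fun m s a => (hC₂ m s a).trans (mul_le_mul_of_nonneg_right
    (show C₂ ≤ C from (le_max_right _ _).trans (le_max_right _ _)) (norm_nonneg _))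
  -- The error is later multiplied by `2 * C`; the choice `ε = (4 * C)⁻¹` leaves half of the free
  -- norm, which can be absorbed.
  obtain ⟨f, D, hD, hf1, hf0, hf⟩ := exists_multiplier_of_sidon Subtype.val_injective hC0 hS₁
    (ε := (4 * C)⁻¹) (by positivity)
  refine ⟨⟨‖(1 : GroupCStar G)‖, fun i => ?_⟩, 2 * C * (2 * D + 1), fun m s a => ?_⟩
  · simpa using (CStarRing.norm_coe_unitary_mul (GroupCStar.universalRep (i : G)) 1).le
  let z : ↥(Λ₁ ∪ Λ₂) → ℂ := fun i => if (i : G) ∈ Λ₁ then 1 else 0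
  have hN₁ := norm_matrixCoeffSum_le_of_subfamily (e := Set.inclusion Set.subset_union_left)
    (Set.inclusion_injective _) (g := fun i : ↥(Λ₁ ∪ Λ₂) => (i : G)) hS₁ s (fun i => z i • a i)
    fun i hi => by
      have : (i : G) ∉ Λ₁ := fun h => hi ⟨⟨i, h⟩, rfl⟩
      simp [z, this]
  have hN₂ := norm_matrixCoeffSum_le_of_subfamily (e := Set.inclusion Set.subset_union_right)
    (Set.inclusion_injective _) (g := fun i : ↥(Λ₁ ∪ Λ₂) => (i : G)) hS₂ s
    (fun i => a i + (-1 : ℂ) • (z i • a i)) fun i hi => by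
      have : (i : G) ∈ Λ₁ := i.2.resolve_right fun h => hi ⟨⟨i, h⟩, rfl⟩
      simp [z, this]
  have hsum := norm_add_le (matrixCoeffSum s (fun i => z i • a i) fun i =>
      (GroupCStar.universalRep (FreeGroup.of i) : GroupCStar (FreeGroup ↥(Λ₁ ∪ Λ₂))))
    (matrixCoeffSum s (fun i => a i + (-1 : ℂ) • (z i • a i)) fun i =>
      (GroupCStar.universalRep (FreeGroup.of i) : GroupCStar (FreeGroup ↥(Λ₁ ∪ Λ₂))))
  rw [← matrixCoeffSum_add] at hsum
  simp only [neg_smul, one_smul, add_neg_cancel_comm_assoc] at hsum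
  have hx := hf m s a fun i => (i : G)
  -- The error `z - f` vanishes on `Λ₁` and is at most `ε` elsewhere; it is measured against the
  -- free norm, the quantity to be bounded.
  have hy := norm_matrixCoeffSum_bounded_le s a (fun i : ↥(Λ₁ ∪ Λ₂) => (i : G))
    (z := fun i => z i - f i) (δ := (4 * C)⁻¹) (by positivity) fun i => by
      by_cases hi : (i : G) ∈ Λ₁
      · have := hf1 ⟨i, hi⟩
        simp only [z, hi, if_true, this, sub_self, norm_zero]
        positivity
      · simp only [z, hi, if_false, zero_sub, norm_neg]
        exact hf0 _ (by simpa using hi)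
  have hz := norm_add_le (matrixCoeffSum s (fun i => f i • a i) fun i =>
      (GroupCStar.universalRep (i : G) : GroupCStar G))
    (matrixCoeffSum s (fun i => (z i - f i) • a i) fun i =>
      (GroupCStar.universalRep (i : G) : GroupCStar G))
  rw [← matrixCoeffSum_add] at hz
  simp only [← add_smul, add_sub_cancel] at hz
  have hw := norm_add_le (matrixCoeffSum s a fun i =>
      (GroupCStar.universalRep (i : G) : GroupCStar G))
    ((-1 : ℂ) • matrixCoeffSum s (fun i => z i • a i) fun i =>
      (GroupCStar.universalRep (i : G) : GroupCStar G))
  rw [← matrixCoeffSum_smul, ← matrixCoeffSum_add, matrixCoeffSum_smul, norm_smul, norm_neg,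
    norm_one, one_mul] at hw
  simp only [neg_smul, one_smul] at hw hN₂
  set X := ‖matrixCoeffSum s a fun i => (GroupCStar.universalRep (i : G) : GroupCStar G)‖
  set Y := ‖matrixCoeffSum s (fun i => z i • a i) fun i =>
    (GroupCStar.universalRep (i : G) : GroupCStar G)‖
  set N := ‖matrixCoeffSum s a fun i =>
    (GroupCStar.universalRep (FreeGroup.of i) : GroupCStar (FreeGroup ↥(Λ₁ ∪ Λ₂)))‖
  have hY : C * Y ≤ C * D * X + N / 4 := by
    have h3 := mul_le_mul_of_nonneg_left (hz.trans (add_le_add hx hy)) hC0.le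
    have h4 : C * ((4 * C)⁻¹ * N) = N / 4 := by field_simp
    rw [mul_add, h4] at h3
    linarith
  -- The two Sidon bounds give `N ≤ C * Y + C * (X + Y)`; inserting `hY` yields `N ≤ C * (2 * D + 1)
  -- * X + N / 2`.
  have h5 := mul_le_mul_of_nonneg_left hw hC0.le
  linarith
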